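/- **Model.** Let $n\ge 1$, $q\in(0,1/2]$, and let $\Theta\in\mathbb R^{n\times n}$ be symmetric with $q+\Theta_{ab}\in[0,1]$ for all $a,b$. Let $z_1,\dots,z_n$ be independent and uniform on $[n]$ (independent sampling); given $z$, let $(Y^\star_{ij})_{1\le i<j\le n}$ be independent Bernoulli variables of parameters $q+\Theta_{z_iz_j}$. Put $Y_{ij}=Y_{ji}=Y^\star_{ij}-q$ and $\bar q=q(1-q)$. **Basis.** For $D\ge 2$ let $\mathcal G_{\le D}$ be a maximal collection of pairwise non-isomorphic finite simple graphs $G=(V,E)$ without isolated nodes and with $1\le |E|\le D$ (templates). Let $\Pi_V$ be the set of injections $V\to[n]$. For $\pi\in\Pi_V$ put $P_{G,\pi}=\prod_{(u,v)\in E}Y_{\pi(u)\pi(v)}$ and, if $G_1,\dots,G_l$ are the connected components of $G$, $$\overline P_{G,\pi}=\prod_{i=1}^{l}\big(P_{G_i,\pi}-\mathbb E[P_{G_i,\pi}]\big),\qquad \Psi_G=\frac{\sum_{\pi\in\Pi_V}\overline P_{G,\pi}}{\sqrt{\mathbb V(G)}},\qquad \mathbb V(G)=\frac{n!}{(n-|V|)!}\,|\mathrm{Aut}(G)|\,\bar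 q^{|E|}.$$ **Notation for two templates.** A matching of $G^{(1)},G^{(2)}$ is a set $\mathbf M\subset V^{(1)}\times V^{(2)}$ in which no node appears twice. It is perfect if every node of both graphs is matched and every edge incident to it is matched to an edge of the other graph. $\Pi(\mathbf M)$ is the set of pairs $(\pi^{(1)},\pi^{(2)})\in\Pi_{V^{(1)}}\times\Pi_{V^{(2)}}$ such that $\pi^{(1)}(v)=\pi^{(2)}(w)$ if and only if $(v,w)\in\mathbf M$. For such a pair, $E_\cap$ and $E_\Delta$ are the intersection and the symmetric difference of the edge sets of the labeled graphs $G^{(1)}[\pi^{(1)}]$ and $G^{(2)}[\pi^{(2)}]$, $V_\Delta$ is the set of endpoints of the edges in $E_\Delta$, and $\#\mathrm{CC}_\Delta$ is the number of connected components of $(V_\Delta,E_\Delta)$; $\#\mathrm{CC}_G$ is the number of connected components of $G$. **Conditions.** Let $k\in\{1,\dots,n\}$ and $\lambda\in\mathbb R$, and put $p=\lambda+q$, $\bar p=p(1-q)^2+(1-p)q^2$. * C-Signal with constant $c_s>1$: $\Theta_{ab}\in[0,\lambda]$ for all $a,b$, and $\frac kn\vee\frac{\lambda k}{\sqrt{nq}}\vee\frac\lambda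 q\le D^{-8c_s}$. * C-Moment with constant $c_m\ge0$: for every template $G=(V,E)$ with at most $D$ edges and every $\pi\in\Pi_V$, $|\mathbb E[P_{G,\pi}]|\le (D^{c_m}\lambda)^{|E|}\big(D^{c_m}\tfrac kn\big)^{|V|-\#\mathrm{CC}_G}$. * C-Variance with constants $c_{v,1},c_{v,2},c_{v,3}\ge0$, $c_{v,4}\ge1$: (1) for all templates $G^{(1)},G^{(2)}$ with at most $D$ edges, every matching $\mathbf M$ that is not perfect, and all $(\pi^{(1)},\pi^{(2)})\in\Pi(\mathbf M)$, $$\big|\mathbb E[P_{G^{(1)},\pi^{(1)}}P_{G^{(2)},\pi^{(2)}}]\big|\le c_{v,2}(D^{c_{v,1}}\lambda)^{|E_\Delta|}\,\bar p^{|E_\cap|}\big(D^{c_{v,1}}\tfrac kn\big)^{|V_\Delta|-\#\mathrm{CC}_\Delta};$$ (2) for every template $G=(V,E)$ with at most $D$ edges and every $\pi\in\Pi_V$, $\big|\mathbb E[P_{G,\pi}^2]-\bar q^{|E|}\big|\le c_{v,3}D^{-c_{v,4}}\bar q^{|E|}$. **Theorem.** For all $c_m,c_{v,1},c_{v,2},c_{v,3}\ge0$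 and $c_{v,4}\ge1$ there are constants $c_0>1$ and $c>0$, depending only on $c_m,c_{v,1},\dots,c_{v,4}$, such that the following holds for all $c_s\ge c_0$, all integers $D\ge2$, and all $n,k,q,\lambda,\Theta$ as above. If C-Signal (with constant $c_s$), C-Moment (with $c_m$) and C-Variance (with $c_{v,1},\dots,c_{v,4}$) hold, then for all real $\alpha_\emptyset$ and $(\alpha_G)_{G\in\mathcal G_{\le D}}$, with $\|\alpha\|_2^2=\alpha_\emptyset^2+\sum_{G\in\mathcal G_{\le D}}\alpha_G^2$, $$\big(1-cD^{-c_s/2}\big)\|\alpha\|_2^2\le\mathbb E\Big[\Big(\alpha_\emptyset+\sum_{G\in\mathcal G_{\le D}}\alpha_G\Psi_G\Big)^2\Big]\le\big(1+cD^{-c_s/2}\big)\|\alpha\|_2^2 .$$ -/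

import Mathlib

open MeasureTheory ProbabilityTheory

noncomputable section

/-! ### The random graph model with latent labels -/

/-- The unordered pairs of distinct nodes of `[n]`, that is, the potential edges. -/
abbrev NodePair (n : ℕ) : Type := {e : Sym2 (Fin n) // ¬ e.IsDiag}

/-- The parameters of the latent structure random graph on the node set `[n]`: the baseline
connection probability `q ∈ (0, 1/2]` and a symmetric matrix `Θ`, such that every `q + Θ a b` is a
probability. -/
structure LatentGraphModel (n : ℕ) where
  q : ℝ
  Θ : Matrix (Fin n) (Fin n) ℝ
  q_pos : 0 < q
  q_le_half : q ≤ 1 / 2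
  Θ_symm : ∀ a b, Θ a b = Θ b a
  prob_mem : ∀ a b, q + Θ a b ∈ Set.Icc (0 : ℝ) 1

/-- A graph whose node set is `{0, …, r - 1}`. -/
abbrev FinGraph : Type := Σ r : ℕ, SimpleGraph (Fin r)

/-- The Bernoulli distribution of parameter `p`. -/
def bernoulliLaw (p : ℝ) : Measure Bool :=
  ENNReal.ofReal p • Measure.dirac true + ENNReal.ofReal (1 - p) • Measure.dirac false

/-- Independent sampling: the labels `z 1, …, z n` are independent and uniform on `[n]`. -/
def latentLaw (n : ℕ) : Measure (Fin n → Fin n) :=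
  Measure.pi fun _ => uniformOn (Set.univ : Set (Fin n))

namespace LatentGraphModel

variable {n : ℕ} (M : LatentGraphModel n)

/-- The conditional connection probability `q + Θ_{z_i z_j}` of the pair `{i, j}`. -/
def edgeProb (z : Fin n → Fin n) : Sym2 (Fin n) → ℝ :=
  Sym2.lift ⟨fun i j => M.q + M.Θ (z i) (z j),
    fun i j => congrArg (M.q + ·) (M.Θ_symm (z i) (z j))⟩

/-- The conditional distribution of the adjacency `Y⋆` given the labels `z`: the entries are
independent Bernoulli variables of parameters `q + Θ_{z_i z_j}`. -/
def condLaw (z : Fin n → Fin n) : Measure (NodePair n → Bool) :=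
  Measure.pi fun e => bernoulliLaw (M.edgeProb z e.1)

/-- The distribution `ℙ` of the adjacency `Y⋆` under independent sampling of the labels. -/
def law : Measure (NodePair n → Bool) :=
  (latentLaw n).bind M.condLaw

/-- The centered adjacency `Y_{ij} = Y⋆_{ij} - q`, for `i ≠ j` (with value `0` on the diagonal, which
is never used). -/
def centered (A : NodePair n → Bool) (e : Sym2 (Fin n)) : ℝ :=
  open Classical in if h : ¬ e.IsDiag then (if A ⟨e, h⟩ then 1 else 0) - M.q else 0

/-! ### The polynomials -/

/-- `P_{G,π} = ∏_{(u,v) ∈ E} Y_{π(u) π(v)}`. -/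
def monoP {r : ℕ} (G : SimpleGraph (Fin r)) (π : Fin r ↪ Fin n) (A : NodePair n → Bool) : ℝ :=
  open Classical in ∏ e ∈ G.edgeFinset, M.centered A (e.map π)

/-- `P̄_{G,π} = ∏_l (P_{G_l,π} - 𝔼 P_{G_l,π})`, the product being over the connected components
`G_l` of `G`. -/
def monoPbar {r : ℕ} (G : SimpleGraph (Fin r)) (π : Fin r ↪ Fin n) (A : NodePair n → Bool) : ℝ :=
  open Classical in
  ∏ C : G.ConnectedComponent,
    (M.monoP (G.induce C.supp).spanningCoe π A
      - ∫ B, M.monoP (G.induce C.supp).spanningCoe π B ∂M.law)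

/-- `P̄_G = ∑_π P̄_{G,π}`, over all injections `π : V → [n]`. -/
def polyPbar (G : FinGraph) (A : NodePair n → Bool) : ℝ :=
  ∑ π : Fin G.1 ↪ Fin n, M.monoPbar G.2 π A

/-- `q̄ = q (1 - q)`. -/
def qbar : ℝ := M.q * (1 - M.q)

/-- `p̄ = p (1 - q)² + (1 - p) q²`, where `p = lam + q`. -/
def pbar (lam : ℝ) : ℝ :=
  (lam + M.q) * (1 - M.q) ^ 2 + (1 - (lam + M.q)) * M.q ^ 2

/-- The variance proxy `𝕍(G) = n! / (n - |V|)! * |Aut G| * q̄ ^ |E|`. -/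
def varProxy (G : FinGraph) : ℝ :=
  (n.descFactorial G.1 : ℝ) * (Nat.card (G.2 ≃g G.2) : ℝ) * M.qbar ^ G.2.edgeSet.ncard

/-- The normalized polynomial `Ψ_G = P̄_G / √𝕍(G)`. -/
def psi (G : FinGraph) (A : NodePair n → Bool) : ℝ :=
  M.polyPbar G A / √(M.varProxy G)

end LatentGraphModel

/-! ### Templates, matchings and merged graphs -/

/-- `G` has no isolated node, at least one edge and at most `D` edges. -/
def IsTemplate (D : ℕ) (G : FinGraph) : Prop :=
  (∀ v, ∃ w, G.2.Adj v w) ∧ 1 ≤ G.2.edgeSet.ncard ∧ G.2.edgeSet.ncard ≤ D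

/-- `𝒢` is a maximal collection of pairwise non-isomorphic templates: it contains exactly one
representative of each isomorphism class. -/
def IsTemplateCollection (D : ℕ) (𝒢 : Finset FinGraph) : Prop :=
  (∀ G ∈ 𝒢, IsTemplate D G) ∧
  (∀ G ∈ 𝒢, ∀ H ∈ 𝒢, Nonempty (G.2 ≃g H.2) → G = H) ∧
  (∀ H, IsTemplate D H → ∃ G ∈ 𝒢, Nonempty (G.2 ≃g H.2))

section Matching

variable {r₁ r₂ n : ℕ}

/-- A matching of nodes: a set of pairs of nodes in which no node appears twice. -/
def IsNodeMatching (m : Set (Fin r₁ × Fin r₂)) : Prop :=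
  ∀ v₁ v₂ w₁ w₂, (v₁, v₂) ∈ m → (w₁, w₂) ∈ m → (v₁ = w₁ ↔ v₂ = w₂)

/-- The labelings `(π₁, π₂)` belong to `Π(m)`. -/
def IsCompatible (m : Set (Fin r₁ × Fin r₂)) (π₁ : Fin r₁ ↪ Fin n) (π₂ : Fin r₂ ↪ Fin n) : Prop :=
  ∀ v₁ v₂, π₁ v₁ = π₂ v₂ ↔ (v₁, v₂) ∈ m

/-- The nodes `v₁` and `v₂` are matched together, and all the edges incident to them are
matched. -/
def PerfectlyMatched (G₁ : SimpleGraph (Fin r₁)) (G₂ : SimpleGraph (Fin r₂))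
    (m : Set (Fin r₁ × Fin r₂)) (v₁ : Fin r₁) (v₂ : Fin r₂) : Prop :=
  (v₁, v₂) ∈ m ∧
  (∀ w₁, G₁.Adj v₁ w₁ → ∃ w₂, (w₁, w₂) ∈ m ∧ G₂.Adj v₂ w₂) ∧
  (∀ w₂, G₂.Adj v₂ w₂ → ∃ w₁, (w₁, w₂) ∈ m ∧ G₁.Adj v₁ w₁)

/-- `m` is a perfect matching: all the nodes of both graphs are perfectly matched. -/
def IsPerfectNodeMatching (G₁ : SimpleGraph (Fin r₁)) (G₂ : SimpleGraph (Fin r₂))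
    (m : Set (Fin r₁ × Fin r₂)) : Prop :=
  (∀ v₁, ∃ v₂, PerfectlyMatched G₁ G₂ m v₁ v₂) ∧ (∀ v₂, ∃ v₁, PerfectlyMatched G₁ G₂ m v₁ v₂)

/-- The intersection `G_∩` of the labeled graphs `G₁[π₁]` and `G₂[π₂]`. -/
def interGraph (G₁ : SimpleGraph (Fin r₁)) (G₂ : SimpleGraph (Fin r₂))
    (π₁ : Fin r₁ ↪ Fin n) (π₂ : Fin r₂ ↪ Fin n) : SimpleGraph (Fin n) :=
  G₁.map π₁ ⊓ G₂.map π₂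

/-- The symmetric difference `G_Δ` of the labeled graphs `G₁[π₁]` and `G₂[π₂]`, carried by `[n]`.
Its node set `V_Δ` is the set of the endpoints of its edges, `(diffGraph …).support`. -/
def diffGraph (G₁ : SimpleGraph (Fin r₁)) (G₂ : SimpleGraph (Fin r₂))
    (π₁ : Fin r₁ ↪ Fin n) (π₂ : Fin r₂ ↪ Fin n) : SimpleGraph (Fin n) :=
  symmDiff (G₁.map π₁) (G₂.map π₂)

end Matching

/-- The number of connected components of a graph. -/
def numCC {V : Type} (G : SimpleGraph V) : ℕ := Nat.card G.ConnectedComponent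

/-! ### The three conditions -/

namespace LatentGraphModel

variable {n : ℕ} (M : LatentGraphModel n)

/-- Condition `C-Signal` with constant `cs`. -/
def CSignal (D k : ℕ) (lam cs : ℝ) : Prop :=
  (∀ a b, M.Θ a b ∈ Set.Icc 0 lam) ∧
  max (max ((k : ℝ) / n) (lam * k / √(n * M.q))) (lam / M.q) ≤ (D : ℝ) ^ (-8 * cs)

/-- Condition `C-Moment` with constant `cm`. -/
def CMoment (D k : ℕ) (lam cm : ℝ) : Prop :=
  ∀ G : FinGraph, IsTemplate D G → ∀ π : Fin G.1 ↪ Fin n,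
    |∫ A, M.monoP G.2 π A ∂M.law| ≤
      ((D : ℝ) ^ cm * lam) ^ G.2.edgeSet.ncard *
        ((D : ℝ) ^ cm * (k / n)) ^ (G.1 - numCC G.2)

/-- Condition `C-Variance` with constants `cv1, cv2, cv3, cv4`. -/
def CVariance (D k : ℕ) (lam cv1 cv2 cv3 cv4 : ℝ) : Prop :=
  (∀ G₁ G₂ : FinGraph, IsTemplate D G₁ → IsTemplate D G₂ →
    ∀ m : Set (Fin G₁.1 × Fin G₂.1), IsNodeMatching m → ¬ IsPerfectNodeMatching G₁.2 G₂.2 m →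
    ∀ (π₁ : Fin G₁.1 ↪ Fin n) (π₂ : Fin G₂.1 ↪ Fin n), IsCompatible m π₁ π₂ →
    let GΔ := diffGraph G₁.2 G₂.2 π₁ π₂
    |∫ A, M.monoP G₁.2 π₁ A * M.monoP G₂.2 π₂ A ∂M.law| ≤
      cv2 * ((D : ℝ) ^ cv1 * lam) ^ GΔ.edgeSet.ncard *
        M.pbar lam ^ (interGraph G₁.2 G₂.2 π₁ π₂).edgeSet.ncard *
        ((D : ℝ) ^ cv1 * (k / n)) ^ (GΔ.support.ncard - numCC (GΔ.induce GΔ.support))) ∧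
  (∀ G : FinGraph, IsTemplate D G → ∀ π : Fin G.1 ↪ Fin n,
    |∫ A, M.monoP G.2 π A ^ 2 ∂M.law - M.qbar ^ G.2.edgeSet.ncard| ≤
      cv3 * (D : ℝ) ^ (-cv4) * M.qbar ^ G.2.edgeSet.ncard)

end LatentGraphModel

end

/-! ### Integration against the law of the graph. -/

noncomputable section

/-! The polynomial `P̄_{G,π}` depends only on the edge set `S` of the labeled graph `G[π]`: it is
`monoBar S`, a product of centered monomials over the components of `S`. Put `φ_S = monoBar S / √q̄
^ |S|`. Collecting labelings by edge set turns `α₀ + ∑ α_G Ψ_G` into `∑ β_S φ_S` over `|S| ≤ D`,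
with `∑ β_S ^ 2 = ‖α‖²` exactly; this is what the normalization `𝕍(G)` is made for (`sum_psi_eq`,
`sum_coeff_sq_eq`). It therefore suffices that the Gram matrix of the `φ_S` is close to the identity
in operator norm, for arbitrary `β`.

Entries. If a component of `S` shares no node with `T`, or conversely, the covariance vanishes,
because the two factors depend on disjoint sets of labels and edges. Otherwise expand both products:
some components are kept as monomials, each other one is replaced by minus its mean. The moment
conditions charge `a` (of order `lam`) per unmatched edge and `b` (of order `k / n`) per unit of
rank, up to powers of `D`. Each connected piece contains a node outside `V(S) ∆ V(T)`, so the total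
rank is at least `|V(S) ∆ V(T)|` (`card_symmDiff_edgeSupp_le`). As rank is at most the number of
edges, each such node is paid by its own edge, and `a * b * √n ≤ y ^ 2 * √q̄` with `y` a small power
of `D`. The normalized entry is thus at most a constant times `y ^ |S ∆ T| * n ^ (-|V(S) ∆ V(T)| /
2)` (`MomentBounds.abs_integral_monoBar_mul_le`).

Operator norm. Schur's test is run with weights `√n ^ |V(S)|`. They turn the entry into `y ^ |S ∆ T|
* n ^ (-|V(T) \ V(S)|)`, where the power of `n` is exactly what the choice of the new nodes of `T`
costs; the choice of the edges among `O(D)` nodes is absorbed by `y`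
(`sum_pow_card_mul_inv_pow_le`). -/

lemma bernoulliLaw_isProbabilityMeasure {p : ℝ} (hp : p ∈ Set.Icc (0 : ℝ) 1) :
    IsProbabilityMeasure (bernoulliLaw p) := by
  constructor
  have h1 : 0 ≤ 1 - p := by linarith [hp.2]
  simp only [bernoulliLaw, Measure.add_apply, Measure.smul_apply, measure_univ, smul_eq_mul,
    mul_one]
  rw [← ENNReal.ofReal_add hp.1 h1]
  simp

lemma integral_bernoulliLaw {p : ℝ} (hp : p ∈ Set.Icc (0 : ℝ) 1) (f : Bool → ℝ) :
    ∫ b, f b ∂bernoulliLaw p = p * f true + (1 - p) * f false := by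
  have h1 : 0 ≤ 1 - p := by linarith [hp.2]
  have := (Measure.dirac true).smul_finite (ENNReal.ofReal_ne_top (r := p))
  have := (Measure.dirac false).smul_finite (ENNReal.ofReal_ne_top (r := 1 - p))
  rw [bernoulliLaw, integral_add_measure Integrable.of_finite Integrable.of_finite,
    integral_smul_measure, integral_smul_measure, integral_dirac, integral_dirac,
    ENNReal.toReal_ofReal hp.1, ENNReal.toReal_ofReal h1]
  simp

namespace LatentGraphModel

variable {n : ℕ} (M : LatentGraphModel n)

lemma edgeProb_mem (z : Fin n → Fin n) (e : Sym2 (Fin n)) :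
    M.edgeProb z e ∈ Set.Icc (0 : ℝ) 1 := by
  induction e with
  | _ a b => exact M.prob_mem (z a) (z b)

lemma condLaw_isProbabilityMeasure (z : Fin n → Fin n) :
    IsProbabilityMeasure (M.condLaw z) := by
  have : ∀ e : NodePair n, IsProbabilityMeasure (bernoulliLaw (M.edgeProb z e.1)) :=
    fun e => bernoulliLaw_isProbabilityMeasure (M.edgeProb_mem z e.1)
  unfold condLaw
  infer_instance

lemma latentLaw_isProbabilityMeasure (hn : n ≠ 0) : IsProbabilityMeasure (latentLaw n) := by
  have : Nonempty (Fin n) := ⟨⟨0, Nat.pos_of_ne_zero hn⟩⟩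
  have : IsProbabilityMeasure (uniformOn (Set.univ : Set (Fin n))) :=
    isProbabilityMeasure_uniformOn Set.finite_univ Set.univ_nonempty
  unfold latentLaw
  infer_instance

lemma latentLaw_real_singleton (z : Fin n → Fin n) :
    (latentLaw n).real {z} = ((n : ℝ) ^ n)⁻¹ := by
  have : IsFiniteMeasure (uniformOn (Set.univ : Set (Fin n))) := by
    unfold uniformOn; infer_instance
  rw [Measure.real, latentLaw, Measure.pi_singleton]
  simp [uniformOn_univ]

lemma law_isProbabilityMeasure (hn : n ≠ 0) : IsProbabilityMeasure M.law := by
  have := latentLaw_isProbabilityMeasure hn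
  have := M.condLaw_isProbabilityMeasure
  constructor
  rw [law, Measure.bind_apply MeasurableSet.univ (measurable_of_finite _).aemeasurable]
  simp

/-- All spaces are finite, so the mixture over labels is a plain average of the `n ^ n` conditional
laws; every later independence statement is a computation with this sum. -/
lemma integral_law (hn : n ≠ 0) (f : (NodePair n → Bool) → ℝ) :
    ∫ A, f A ∂M.law = ((n : ℝ) ^ n)⁻¹ * ∑ z : Fin n → Fin n, ∫ A, f A ∂M.condLaw z := by
  have := latentLaw_isProbabilityMeasure hn
  have := M.law_isProbabilityMeasure hn
  have := M.condLaw_isProbabilityMeasure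
  have key : ∀ A, M.law.real {A} = ((n : ℝ) ^ n)⁻¹ * ∑ z, (M.condLaw z).real {A} := by
    intro A
    rw [Measure.real, law, Measure.bind_apply (measurableSet_singleton A)
      (measurable_of_finite _).aemeasurable, lintegral_fintype, ENNReal.toReal_sum,
      Finset.mul_sum]
    · refine Finset.sum_congr rfl fun z _ => ?_
      rw [ENNReal.toReal_mul, mul_comm, ← latentLaw_real_singleton z]
      rfl
    · intro z _
      exact ENNReal.mul_ne_top (measure_ne_top _ _) (measure_ne_top _ _)
  rw [integral_fintype Integrable.of_finite]
  simp_rw [integral_fintype (Integrable.of_finite (μ := M.condLaw _) (f := f)), key, smul_eq_mul,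
    mul_assoc, Finset.sum_mul, ← Finset.mul_sum]
  rw [Finset.sum_comm]

/-- The average over the labels of a product over the potential edges. -/
lemma integral_law_prod (hn : n ≠ 0) (f : NodePair n → Bool → ℝ) :
    ∫ A, ∏ e, f e (A e) ∂M.law = ((n : ℝ) ^ n)⁻¹ * ∑ z : Fin n → Fin n,
      ∏ e : NodePair n,
        (M.edgeProb z e.1 * f e true + (1 - M.edgeProb z e.1) * f e false) := by
  rw [M.integral_law hn]
  congr 1
  refine Finset.sum_congr rfl fun z _ => ?_
  have : ∀ e : NodePair n, IsProbabilityMeasure (bernoulliLaw (M.edgeProb z e.1)) :=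
    fun e => bernoulliLaw_isProbabilityMeasure (M.edgeProb_mem z e.1)
  rw [condLaw, integral_fintype_prod_eq_prod (μ := fun e : NodePair n =>
    bernoulliLaw (M.edgeProb z e.1)) f]
  exact Finset.prod_congr rfl fun e _ => integral_bernoulliLaw (M.edgeProb_mem z e.1) _

/-- The average over the labels of a product over a set of potential edges. -/
lemma integral_law_prod_finset (hn : n ≠ 0) (S : Finset (NodePair n))
    (f : NodePair n → Bool → ℝ) :
    ∫ A, ∏ e ∈ S, f e (A e) ∂M.law = ((n : ℝ) ^ n)⁻¹ * ∑ z : Fin n → Fin n,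
      ∏ e ∈ S, (M.edgeProb z e.1 * f e true + (1 - M.edgeProb z e.1) * f e false) := by
  classical
  have h := M.integral_law_prod hn (fun e b => if e ∈ S then f e b else 1)
  simp only [Finset.prod_ite_mem, Finset.univ_inter] at h
  rw [h]
  congr 1
  refine Finset.sum_congr rfl fun z _ => ?_
  rw [← Finset.prod_subset (Finset.subset_univ S)]
  · refine Finset.prod_congr rfl fun e he => ?_
    simp [he]
  · intro e _ he
    simp [he]

end LatentGraphModel

/-- Functions of disjoint sets of coordinates are uncorrelated under the uniform law. -/
lemma average_mul_of_disjoint {n : ℕ} (hn : n ≠ 0) (W : Finset (Fin n))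
    (F G : (Fin n → Fin n) → ℝ)
    (hF : ∀ z z', (∀ v ∈ W, z v = z' v) → F z = F z')
    (hG : ∀ z z', (∀ v ∉ W, z v = z' v) → G z = G z') :
    ((n : ℝ) ^ n)⁻¹ * ∑ z, F z * G z =
      (((n : ℝ) ^ n)⁻¹ * ∑ z, F z) * (((n : ℝ) ^ n)⁻¹ * ∑ z, G z) := by
  classical
  let ι := Equiv.piEquivPiSubtypeProd (fun v => v ∈ W) (fun _ : Fin n => Fin n)
  -- An arbitrary reference labeling, used to freeze the coordinates on which a function does not
  -- depend.
  let z₀ : Fin n → Fin n := fun v => v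
  let F' : ({v // v ∈ W} → Fin n) → ℝ := fun a => F (ι.symm (a, fun v => z₀ v))
  let G' : ({v // v ∉ W} → Fin n) → ℝ := fun b => G (ι.symm (fun v => z₀ v, b))
  have hF' : ∀ a b, F (ι.symm (a, b)) = F' a := by
    intro a b
    refine hF _ _ fun v hv => ?_
    simp [ι, Equiv.piEquivPiSubtypeProd, hv]
  have hG' : ∀ a b, G (ι.symm (a, b)) = G' b := by
    intro a b
    refine hG _ _ fun v hv => ?_
    simp [ι, Equiv.piEquivPiSubtypeProd, hv]
  have hs : ∀ H : (Fin n → Fin n) → ℝ, ∑ z, H z = ∑ a, ∑ b, H (ι.symm (a, b)) := by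
    intro H
    rw [← Fintype.sum_prod_type', ← ι.symm.sum_comp]
  have hn' : (n : ℝ) ≠ 0 := Nat.cast_ne_zero.2 hn
  rw [hs, hs F, hs G]
  simp only [hF', hG', ← Finset.mul_sum, ← Finset.sum_mul, Finset.sum_const, nsmul_eq_mul,
    Finset.card_univ]
  have hc : ((Fintype.card ({v // v ∈ W} → Fin n) : ℝ)) *
      (Fintype.card ({v // v ∉ W} → Fin n) : ℝ) = (n : ℝ) ^ n := by
    have := Fintype.card_congr ι
    rw [Fintype.card_prod] at this
    rw [← Nat.cast_mul, ← this]
    simp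
  have hc0 : (n : ℝ) ^ n ≠ 0 := pow_ne_zero _ hn'
  rw [← hc] at hc0 ⊢
  have h1 := left_ne_zero_of_mul hc0
  have h2 := right_ne_zero_of_mul hc0
  field_simp

namespace LatentGraphModel

variable {n : ℕ} (M : LatentGraphModel n)

/-- The set of the endpoints of a set of potential edges. -/
def _root_.edgeSupp (S : Finset (NodePair n)) : Finset (Fin n) :=
  open Classical in Finset.univ.filter fun v => ∃ e ∈ S, v ∈ e.1

/-- The centered monomial attached to a set of potential edges. -/
def mono (S : Finset (NodePair n)) (A : NodePair n → Bool) : ℝ :=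
  ∏ e ∈ S, ((if A e then 1 else 0) - M.q)

lemma _root_.mem_edgeSupp {S : Finset (NodePair n)} {v : Fin n} :
    v ∈ edgeSupp S ↔ ∃ e ∈ S, v ∈ e.1 := by
  simp [edgeSupp]

lemma edgeProb_congr {z z' : Fin n → Fin n} {e : Sym2 (Fin n)} (h : ∀ v ∈ e, z v = z' v) :
    M.edgeProb z e = M.edgeProb z' e := by
  induction e with
  | _ a b =>
    have ha := h a (by simp)
    have hb := h b (by simp)
    simp [edgeProb, ha, hb]

/-- Products over vertex-disjoint sets of potential edges are uncorrelated. -/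
lemma integral_law_mul_of_disjoint (hn : n ≠ 0) {S T : Finset (NodePair n)}
    (hST : Disjoint (edgeSupp S) (edgeSupp T)) (f g : NodePair n → Bool → ℝ) :
    ∫ A, (∏ e ∈ S, f e (A e)) * ∏ e ∈ T, g e (A e) ∂M.law =
      (∫ A, ∏ e ∈ S, f e (A e) ∂M.law) * ∫ A, ∏ e ∈ T, g e (A e) ∂M.law := by
  classical
  -- Having no common node is stronger than having no common edge. Disjoint edge sets allow the two
  -- products to be glued over `S ∪ T`; disjoint endpoints then separate the labels.
  have hd : Disjoint S T := by
    rw [Finset.disjoint_left] at hST ⊢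
    intro e he he'
    obtain ⟨v, hv⟩ : ∃ v, v ∈ e.1 := ⟨_, Sym2.out_fst_mem e.1⟩
    exact hST (mem_edgeSupp.2 ⟨e, he, hv⟩) (mem_edgeSupp.2 ⟨e, he', hv⟩)
  have h := M.integral_law_prod_finset hn (S ∪ T) (fun e b => if e ∈ S then f e b else g e b)
  have hT : ∀ e ∈ T, e ∉ S := fun e he he' => Finset.disjoint_left.1 hd he' he
  have split : ∀ u v w : NodePair n → ℝ, (∀ e ∈ S, w e = u e) → (∀ e ∉ S, w e = v e) →
      ∏ e ∈ S ∪ T, w e = (∏ e ∈ S, u e) * ∏ e ∈ T, v e := by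
    intro u v w hu hv
    rw [Finset.prod_union hd, Finset.prod_congr rfl hu,
      Finset.prod_congr rfl fun e he => hv e (hT e he)]
  have e1 : ∀ A : NodePair n → Bool,
      (∏ e ∈ S ∪ T, if e ∈ S then f e (A e) else g e (A e)) =
        (∏ e ∈ S, f e (A e)) * ∏ e ∈ T, g e (A e) := fun A =>
    split (fun e => f e (A e)) (fun e => g e (A e)) _ (fun e he => by simp [he])
      (fun e he => by simp [he])
  simp only [e1] at h
  rw [h, M.integral_law_prod_finset hn, M.integral_law_prod_finset hn,
    ← average_mul_of_disjoint hn (edgeSupp S)]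
  · congr 1
    refine Finset.sum_congr rfl fun z _ => ?_
    refine split (fun e => M.edgeProb z e.1 * f e true + (1 - M.edgeProb z e.1) * f e false)
      (fun e => M.edgeProb z e.1 * g e true + (1 - M.edgeProb z e.1) * g e false) _ ?_ ?_
    · intro e he
      simp [he]
    · intro e he
      simp [he]
  · intro z z' hz
    refine Finset.prod_congr rfl fun e he => ?_
    rw [M.edgeProb_congr fun v hv => hz v (mem_edgeSupp.2 ⟨e, he, hv⟩)]
  · intro z z' hz
    refine Finset.prod_congr rfl fun e he => ?_
    rw [M.edgeProb_congr fun v hv => hz v fun hv' =>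
      Finset.disjoint_left.1 hST hv' (mem_edgeSupp.2 ⟨e, he, hv⟩)]

lemma qbar_pos : 0 < M.qbar := by
  have h1 := M.q_pos
  have h2 := M.q_le_half
  exact mul_pos h1 (by linarith)

lemma pbar_eq (lam : ℝ) : M.pbar lam = M.qbar + lam * (1 - 2 * M.q) := by
  unfold pbar qbar; ring

/-- The second moment of a monomial lies between the powers of `q̄` and of `p̄`. -/
lemma integral_mono_sq_mem (hn : n ≠ 0) {lam : ℝ} (hΘ : ∀ a b, M.Θ a b ∈ Set.Icc 0 lam)
    (S : Finset (NodePair n)) :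
    ∫ A, M.mono S A ^ 2 ∂M.law ∈ Set.Icc (M.qbar ^ S.card) (M.pbar lam ^ S.card) := by
  have hn' : (n : ℝ) ≠ 0 := Nat.cast_ne_zero.2 hn
  have hc0 : (n : ℝ) ^ n ≠ 0 := pow_ne_zero _ hn'
  have hq := M.q_le_half
  have h := M.integral_law_prod_finset hn S
    (fun _ b => ((if b then 1 else 0) - M.q) ^ 2)
  simp only [Finset.prod_pow] at h
  have avg : ∀ c : ℝ, c = ((n : ℝ) ^ n)⁻¹ * ∑ _z : Fin n → Fin n, c := by
    intro c
    simp [hc0]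
  -- The conditional second moment of an edge is `q̄ + Θ_{ab} * (1 - 2q)`, nondecreasing in `Θ_{ab}
  -- ∈ [0, lam]` because `q ≤ 1/2`.
  have hfac : ∀ (z : Fin n → Fin n) (e : NodePair n),
      M.edgeProb z e.1 * ((if true = true then (1 : ℝ) else 0) - M.q) ^ 2
        + (1 - M.edgeProb z e.1) * ((if false = true then (1 : ℝ) else 0) - M.q) ^ 2
        ∈ Set.Icc M.qbar (M.pbar lam) := by
    intro z ⟨e, he⟩
    induction e with
    | _ a b =>
      have := hΘ (z a) (z b)
      rw [pbar_eq]
      simp only [edgeProb, Sym2.lift_mk, if_true, qbar]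
      constructor <;> simp <;> nlinarith [this.1, this.2]
  have hinv : 0 ≤ ((n : ℝ) ^ n)⁻¹ := by positivity
  unfold mono
  rw [h]
  constructor
  · rw [avg (M.qbar ^ S.card)]
    gcongr with z
    rw [← Finset.prod_const]
    exact Finset.prod_le_prod (fun e _ => M.qbar_pos.le) fun e _ => (hfac z e).1
  · rw [avg (M.pbar lam ^ S.card)]
    gcongr with z
    rw [← Finset.prod_const]
    exact Finset.prod_le_prod (fun e _ => M.qbar_pos.le.trans (hfac z e).1)
      fun e _ => (hfac z e).2

end LatentGraphModel

/-- The number of nodes of a finite graph is at most its number of edges plus its number of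
connected components. -/
lemma card_le_card_edgeSet_add_numCC {V : Type} [Finite V] (G : SimpleGraph V) :
    Nat.card V ≤ G.edgeSet.ncard + numCC G := by
  classical
  have := Fintype.ofFinite V
  -- A spanning forest: every node other than the root of its component selects an edge towards a
  -- node nearer to the root. Two nodes selecting the same edge would each be nearer than the other,
  -- so the selection is injective.
  let root : V → V := fun v => (G.connectedComponentMk v).out
  have hroot : ∀ v, G.Reachable v (root v) := fun v =>
    SimpleGraph.ConnectedComponent.exact (Quot.out_eq (G.connectedComponentMk v)).symm
  have hpar : ∀ v, v ≠ root v → ∃ w, G.Adj v w ∧ G.dist w (root w) < G.dist v (root v) := by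
    intro v hv
    obtain ⟨p, hp⟩ := (hroot v).exists_walk_length_eq_dist
    generalize hr : root v = r at *
    cases p with
    | nil => exact absurd rfl hv
    | @cons _ w _ h q =>
      refine ⟨w, h, ?_⟩
      have : root w = r := by
        rw [← hr]
        simp only [root]
        rw [SimpleGraph.ConnectedComponent.sound h.reachable]
      rw [this, ← hp, SimpleGraph.Walk.length_cons]
      exact Nat.lt_succ_of_le (SimpleGraph.dist_le q)
  choose! par hadj hdist using hpar
  have hcc : (Set.range root).ncard ≤ numCC G := by
    have : Set.range root ⊆ Set.range (fun C : G.ConnectedComponent => Quot.out C) := by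
      rintro _ ⟨v, rfl⟩
      exact ⟨_, rfl⟩
    refine (Set.ncard_le_ncard this (Set.toFinite _)).trans ?_
    rw [← Nat.card_coe_set_eq]
    exact Finite.card_range_le _
  have hne : ∀ v ∈ (Set.range root)ᶜ, v ≠ root v := fun v hv h => hv ⟨v, h.symm⟩
  have hed : ((Set.range root)ᶜ).ncard ≤ G.edgeSet.ncard := by
    refine Set.ncard_le_ncard_of_injOn (fun v => s(v, par v)) ?_ ?_ (Set.toFinite _)
    · intro v hv
      exact hadj v (hne v hv)
    · intro v hv w hw h
      rcases Sym2.eq_iff.1 h with h | h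
      · exact h.1
      · have h1 := hdist v (hne v hv)
        have h2 := hdist w (hne w hw)
        rw [h.2] at h1
        rw [← h.1] at h2
        omega
  have := Set.ncard_add_ncard_compl (Set.range root)
  omega

/-! ### Labeled graphs as sets of node pairs, and their rank. -/

section EdgeSets

variable {n : ℕ}

/-- The graph on `[n]` with a given set of edges. -/
def graphOf (S : Finset (NodePair n)) : SimpleGraph (Fin n) :=
  SimpleGraph.fromEdgeSet (Subtype.val '' (S : Set (NodePair n)))

/-- The rank of a set of edges: the number of endpoints minus the number of connected
components. -/
def edgeRank (S : Finset (NodePair n)) : ℕ :=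
  (graphOf S).support.ncard - numCC ((graphOf S).induce (graphOf S).support)

lemma edgeSet_graphOf (S : Finset (NodePair n)) :
    (graphOf S).edgeSet = Subtype.val '' (S : Set (NodePair n)) := by
  rw [graphOf, SimpleGraph.edgeSet_fromEdgeSet, sdiff_eq_left, Set.disjoint_left]
  rintro _ ⟨e, _, rfl⟩ he
  exact e.2 he

lemma ncard_edgeSet_graphOf (S : Finset (NodePair n)) :
    (graphOf S).edgeSet.ncard = S.card := by
  rw [edgeSet_graphOf, Set.ncard_image_of_injective _ Subtype.val_injective,
    Set.ncard_coe_finset]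

lemma graphOf_adj {S : Finset (NodePair n)} {a b : Fin n} :
    (graphOf S).Adj a b ↔ ∃ e ∈ S, e.1 = s(a, b) := by
  rw [← SimpleGraph.mem_edgeSet, edgeSet_graphOf]
  simp

lemma graphOf_adj_of_mem {S : Finset (NodePair n)} {e : NodePair n} (he : e ∈ S) {a b : Fin n}
    (ha : a ∈ e.1) (hb : b ∈ e.1) (hab : a ≠ b) : (graphOf S).Adj a b :=
  graphOf_adj.2 ⟨e, he, ((Sym2.mem_and_mem_iff hab).1 ⟨ha, hb⟩)⟩

lemma reachable_of_mem {S : Finset (NodePair n)} {e : NodePair n} (he : e ∈ S) {a b : Fin n}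
    (ha : a ∈ e.1) (hb : b ∈ e.1) : (graphOf S).Reachable a b := by
  by_cases hab : a = b
  · rw [hab]
  · exact (graphOf_adj_of_mem he ha hb hab).reachable

lemma support_graphOf (S : Finset (NodePair n)) :
    (graphOf S).support = (edgeSupp S : Set (Fin n)) := by
  ext v
  rw [SimpleGraph.mem_support, Finset.mem_coe, mem_edgeSupp]
  constructor
  · rintro ⟨w, h⟩
    obtain ⟨e, he, h⟩ := graphOf_adj.1 h
    exact ⟨e, he, by simp [h]⟩
  · rintro ⟨⟨e, hd⟩, he, hv⟩
    obtain ⟨w, rfl⟩ := hv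
    exact ⟨w, graphOf_adj.2 ⟨_, he, rfl⟩⟩

lemma ncard_support_graphOf (S : Finset (NodePair n)) :
    (graphOf S).support.ncard = (edgeSupp S).card := by
  rw [support_graphOf, Set.ncard_coe_finset]

lemma edgeSupp_mono {S T : Finset (NodePair n)} (h : S ⊆ T) : edgeSupp S ⊆ edgeSupp T := by
  intro v hv
  obtain ⟨e, he, hv⟩ := mem_edgeSupp.1 hv
  exact mem_edgeSupp.2 ⟨e, h he, hv⟩

lemma edgeSupp_empty : edgeSupp (∅ : Finset (NodePair n)) = ∅ := by
  ext v; simp [mem_edgeSupp]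

lemma edgeSupp_nonempty {S : Finset (NodePair n)} (h : S.Nonempty) : (edgeSupp S).Nonempty := by
  obtain ⟨e, he⟩ := h
  exact ⟨_, mem_edgeSupp.2 ⟨e, he, Sym2.out_fst_mem e.1⟩⟩

lemma card_edgeSupp_le (S : Finset (NodePair n)) : (edgeSupp S).card ≤ 2 * S.card := by
  classical
  have : edgeSupp S ⊆ S.biUnion fun e => e.1.toFinset := by
    intro v hv
    obtain ⟨e, he, hv⟩ := mem_edgeSupp.1 hv
    exact Finset.mem_biUnion.2 ⟨e, he, by simpa using hv⟩
  refine (Finset.card_le_card this).trans (Finset.card_biUnion_le.trans ?_)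
  rw [mul_comm, ← smul_eq_mul]
  refine Finset.sum_le_card_nsmul _ _ _ fun e _ => ?_
  rw [Sym2.card_toFinset]
  split_ifs <;> norm_num

lemma edgeRank_empty : edgeRank (∅ : Finset (NodePair n)) = 0 := by
  rw [edgeRank, ncard_support_graphOf, edgeSupp_empty]; simp

/-- Reachability between nodes of the support holds inside the support. -/
lemma reachable_induce_support {V : Type} {G : SimpleGraph V} {v w : V}
    (h : G.Reachable v w) (hv : v ∈ G.support) (hw : w ∈ G.support) :
    (G.induce G.support).Reachable ⟨v, hv⟩ ⟨w, hw⟩ := by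
  obtain ⟨p⟩ := h
  induction p with
  | nil => exact SimpleGraph.Reachable.refl _
  | @cons a b c hab p ih =>
    have hb : b ∈ G.support := ⟨a, hab.symm⟩
    have : (G.induce G.support).Adj ⟨a, hv⟩ ⟨b, hb⟩ := hab
    exact this.reachable.trans (ih hb hw)

/-- A set of nodes that misses at least one node of each connected component has at most `rank`
elements. -/
lemma card_le_edgeRank {S : Finset (NodePair n)} {W : Finset (Fin n)} (hW : W ⊆ edgeSupp S)
    (h : ∀ v ∈ edgeSupp S, ∃ w ∈ edgeSupp S, w ∉ W ∧ (graphOf S).Reachable v w) :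
    W.card ≤ edgeRank S := by
  classical
  have hs := support_graphOf S
  have hmem : ∀ v, v ∈ (graphOf S).support ↔ v ∈ edgeSupp S := fun v => by rw [hs]; simp
  -- The nodes outside `W` reach every component, so the number of components is at most `|V| -
  -- |W|`.
  let f : {v // v ∈ edgeSupp S \ W} →
      ((graphOf S).induce (graphOf S).support).ConnectedComponent := fun v =>
    SimpleGraph.connectedComponentMk _ ⟨v.1, (hmem _).2 (Finset.mem_sdiff.1 v.2).1⟩
  have hf : Function.Surjective f := by
    intro C
    induction C using SimpleGraph.ConnectedComponent.ind with
    | _ v =>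
      obtain ⟨w, hw, hwW, hr⟩ := h v.1 ((hmem _).1 v.2)
      refine ⟨⟨w, Finset.mem_sdiff.2 ⟨hw, hwW⟩⟩, ?_⟩
      exact SimpleGraph.ConnectedComponent.sound
        (reachable_induce_support hr v.2 ((hmem _).2 hw)).symm
  have h1 := Nat.card_le_card_of_surjective f hf
  rw [Nat.card_eq_fintype_card (α := {v // v ∈ edgeSupp S \ W}), Fintype.card_coe,
    Finset.card_sdiff_of_subset hW] at h1
  have h2 := Finset.card_le_card hW
  rw [edgeRank, ncard_support_graphOf]
  unfold numCC
  omega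

/-- A set of edges comes from a labeled graph without isolated nodes. -/
lemma exists_template (S : Finset (NodePair n)) :
    ∃ (r : ℕ) (G : SimpleGraph (Fin r)) (π : Fin r ↪ Fin n), G.map π = graphOf S ∧
      (∀ v, ∃ w, G.Adj v w) ∧ G.edgeSet.ncard = S.card ∧ r - numCC G = edgeRank S ∧
      r ≤ G.edgeSet.ncard + numCC G := by
  classical
  obtain ⟨r, hr, ⟨e⟩⟩ : ∃ r, r = Nat.card (graphOf S).support ∧
      Nonempty (Fin r ≃ (graphOf S).support) := ⟨_, rfl, ⟨(Finite.equivFin _).symm⟩⟩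
  let G₀ := (graphOf S).induce (graphOf S).support
  let π : Fin r ↪ Fin n := e.toEmbedding.trans (Function.Embedding.subtype _)
  have hπ : ∀ x, π (e.symm x) = x := fun x => congrArg Subtype.val (e.apply_symm_apply x)
  have hmap : (G₀.comap e).map π = graphOf S := by
    ext a b
    rw [SimpleGraph.map_adj]
    constructor
    · rintro ⟨u, v, huv, rfl, rfl⟩
      exact huv
    · intro hab
      refine ⟨e.symm ⟨a, b, hab⟩, e.symm ⟨b, a, hab.symm⟩, ?_, hπ _, hπ _⟩
      change (graphOf S).Adj (π _) (π _)
      rwa [hπ, hπ]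
  have hcc : numCC (G₀.comap e) = numCC G₀ :=
    Nat.card_congr (SimpleGraph.Iso.comap e G₀).connectedComponentEquiv
  refine ⟨_, G₀.comap e, π, hmap, ?_, ?_, ?_, ?_⟩
  · intro v
    obtain ⟨w, hw⟩ := (SimpleGraph.mem_support _).1 (e v).2
    refine ⟨e.symm ⟨w, _, hw.symm⟩, ?_⟩
    change (graphOf S).Adj (e v) (π _)
    rwa [hπ]
  · have h := congrArg (fun H => H.edgeSet.ncard) hmap
    simp only [ncard_edgeSet_graphOf] at h
    rw [← h, SimpleGraph.edgeSet_map,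
      Set.ncard_image_of_injective _ (Function.Embedding.injective _)]
  · rw [hcc, edgeRank, hr, Nat.card_coe_set_eq]
  · have := card_le_card_edgeSet_add_numCC (G₀.comap e)
    simpa using this

lemma edgeRank_le_card (S : Finset (NodePair n)) : edgeRank S ≤ S.card := by
  obtain ⟨r, G, π, -, -, h1, h2, h3⟩ := exists_template S
  omega

/-! ### Connected components of a set of edges -/

open Classical in
/-- The edge sets of the connected components of a set of edges. -/
def edgeComps (S : Finset (NodePair n)) : Finset (Finset (NodePair n)) :=
  S.image fun e => S.filter fun e' => ∃ v ∈ e.1, ∃ w ∈ e'.1, (graphOf S).Reachable v w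

lemma mem_edgeComps {S C : Finset (NodePair n)} :
    C ∈ edgeComps S ↔ ∃ e ∈ S, ∀ e', e' ∈ C ↔
      e' ∈ S ∧ ∃ v ∈ e.1, ∃ w ∈ e'.1, (graphOf S).Reachable v w := by
  classical
  rw [edgeComps, Finset.mem_image]
  constructor
  · rintro ⟨e, he, rfl⟩
    exact ⟨e, he, fun e' => Finset.mem_filter⟩
  · rintro ⟨e, he, h⟩
    exact ⟨e, he, by ext e'; rw [h, Finset.mem_filter]⟩

lemma subset_of_mem_edgeComps {S C : Finset (NodePair n)} (h : C ∈ edgeComps S) : C ⊆ S := by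
  obtain ⟨e, -, h⟩ := mem_edgeComps.1 h
  exact fun e' he' => ((h e').1 he').1

lemma nonempty_of_mem_edgeComps {S C : Finset (NodePair n)} (h : C ∈ edgeComps S) :
    C.Nonempty := by
  obtain ⟨e, he, h⟩ := mem_edgeComps.1 h
  exact ⟨e, (h e).2 ⟨he, _, Sym2.out_fst_mem e.1, _, Sym2.out_fst_mem e.1,
    SimpleGraph.Reachable.refl _⟩⟩

lemma mem_of_reachable {S C : Finset (NodePair n)} (h : C ∈ edgeComps S) {e e' : NodePair n}
    (he : e ∈ C) (he' : e' ∈ S) {v w : Fin n} (hv : v ∈ e.1) (hw : w ∈ e'.1)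
    (hr : (graphOf S).Reachable v w) : e' ∈ C := by
  obtain ⟨e₀, he₀, h⟩ := mem_edgeComps.1 h
  obtain ⟨heS, a, ha, b, hb, hab⟩ := (h e).1 he
  exact (h e').2 ⟨he', a, ha, w, hw, (hab.trans (reachable_of_mem heS hb hv)).trans hr⟩

lemma exists_mem_edgeComps {S : Finset (NodePair n)} {e : NodePair n} (he : e ∈ S) :
    ∃ C ∈ edgeComps S, e ∈ C := by
  classical
  refine ⟨S.filter fun e' => ∃ v ∈ e.1, ∃ w ∈ e'.1, (graphOf S).Reachable v w,
    mem_edgeComps.2 ⟨e, he, fun e' => Finset.mem_filter⟩, Finset.mem_filter.2 ⟨he, _,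
    Sym2.out_fst_mem e.1, _, Sym2.out_fst_mem e.1, SimpleGraph.Reachable.refl _⟩⟩

/-- Distinct components are disjoint as sets of nodes, not merely of edges; this is what makes a
component independent of the others. -/
lemma eq_of_mem_edgeSupp {S C C' : Finset (NodePair n)} (h : C ∈ edgeComps S)
    (h' : C' ∈ edgeComps S) {v : Fin n} (hv : v ∈ edgeSupp C) (hv' : v ∈ edgeSupp C') :
    C = C' := by
  obtain ⟨e, he, hve⟩ := mem_edgeSupp.1 hv
  obtain ⟨e', he', hve'⟩ := mem_edgeSupp.1 hv'
  have hS := subset_of_mem_edgeComps h he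
  have hS' := subset_of_mem_edgeComps h' he'
  have key : ∀ e₀ ∈ S, e₀ ∈ C ↔ e₀ ∈ C' := by
    intro e₀ he₀
    constructor
    · intro h₀
      obtain ⟨e₁, he₁, h₁⟩ := mem_edgeComps.1 h
      obtain ⟨-, a, ha, b, hb, hab⟩ := (h₁ e).1 he
      obtain ⟨-, a', ha', b', hb', hab'⟩ := (h₁ e₀).1 h₀
      refine mem_of_reachable h' he' he₀ hve' hb' ?_
      exact (((reachable_of_mem hS hve hb).trans hab.symm).trans
        (reachable_of_mem he₁ ha ha')).trans hab'
    · intro h₀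
      obtain ⟨e₁, he₁, h₁⟩ := mem_edgeComps.1 h'
      obtain ⟨-, a, ha, b, hb, hab⟩ := (h₁ e').1 he'
      obtain ⟨-, a', ha', b', hb', hab'⟩ := (h₁ e₀).1 h₀
      refine mem_of_reachable h he he₀ hve hb' ?_
      exact (((reachable_of_mem hS' hve' hb).trans hab.symm).trans
        (reachable_of_mem he₁ ha ha')).trans hab'
  ext e₀
  constructor
  · exact fun h₀ => (key e₀ (subset_of_mem_edgeComps h h₀)).1 h₀
  · exact fun h₀ => (key e₀ (subset_of_mem_edgeComps h' h₀)).2 h₀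

lemma pairwiseDisjoint_edgeComps (S : Finset (NodePair n)) :
    (edgeComps S : Set (Finset (NodePair n))).PairwiseDisjoint id := by
  intro C hC C' hC' hne
  rw [Function.onFun, Finset.disjoint_left]
  intro e he he'
  exact hne (eq_of_mem_edgeSupp hC hC' (mem_edgeSupp.2 ⟨e, he, Sym2.out_fst_mem e.1⟩)
    (mem_edgeSupp.2 ⟨e, he', Sym2.out_fst_mem e.1⟩))

open Classical in
lemma biUnion_edgeComps (S : Finset (NodePair n)) : (edgeComps S).biUnion id = S := by
  ext e
  rw [Finset.mem_biUnion]
  constructor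
  · rintro ⟨C, hC, he⟩
    exact subset_of_mem_edgeComps hC he
  · exact fun he => exists_mem_edgeComps he

/-- A walk in `S` started in a component never leaves it: an edge of `S` touching a node of `C`
belongs to `C`. -/
lemma reachable_of_mem_edgeComps {S C : Finset (NodePair n)} (h : C ∈ edgeComps S) {v w : Fin n}
    (hv : v ∈ edgeSupp C) (hw : w ∈ edgeSupp C) : (graphOf C).Reachable v w := by
  have hS : (graphOf S).Reachable v w := by
    obtain ⟨e, he, hve⟩ := mem_edgeSupp.1 hv
    obtain ⟨e', he', hwe⟩ := mem_edgeSupp.1 hw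
    obtain ⟨e₁, he₁, h₁⟩ := mem_edgeComps.1 h
    obtain ⟨heS, a, ha, b, hb, hab⟩ := (h₁ e).1 he
    obtain ⟨he'S, a', ha', b', hb', hab'⟩ := (h₁ e').1 he'
    exact ((((reachable_of_mem heS hve hb).trans hab.symm).trans
        (reachable_of_mem he₁ ha ha')).trans hab').trans (reachable_of_mem he'S hb' hwe)
  obtain ⟨p⟩ := hS
  clear hw
  induction p with
  | nil => exact SimpleGraph.Reachable.refl _
  | @cons a b c hab p ih =>
    obtain ⟨e', he', hab'⟩ := graphOf_adj.1 hab
    obtain ⟨e, he, hae⟩ := mem_edgeSupp.1 hv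
    have heC : e' ∈ C := mem_of_reachable h he he' hae (w := a) (by simp [hab'])
      (SimpleGraph.Reachable.refl _)
    have hb : b ∈ edgeSupp C := mem_edgeSupp.2 ⟨e', heC, by simp [hab']⟩
    exact (graphOf_adj.2 ⟨e', heC, hab'⟩).reachable.trans (ih hb)

lemma card_edgeComps_le (S : Finset (NodePair n)) : (edgeComps S).card ≤ S.card := by
  classical
  exact Finset.card_image_le

lemma sum_card_edgeComps (S : Finset (NodePair n)) :
    ∑ C ∈ edgeComps S, C.card = S.card := by
  classical
  conv_rhs => rw [← biUnion_edgeComps S]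
  rw [Finset.card_biUnion (pairwiseDisjoint_edgeComps S)]
  rfl

end EdgeSets

/-! ### Transfer of the moment conditions from templates to edge sets. -/

namespace LatentGraphModel

variable {n : ℕ} (M : LatentGraphModel n)

lemma mono_empty (A : NodePair n → Bool) : M.mono ∅ A = 1 := by simp [mono]

open Classical in
lemma prod_mono_eq {S : Finset (NodePair n)} {𝒜 : Finset (Finset (NodePair n))}
    (h𝒜 : 𝒜 ⊆ edgeComps S) (A : NodePair n → Bool) :
    ∏ C ∈ 𝒜, M.mono C A = M.mono (𝒜.biUnion id) A := by
  unfold mono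
  rw [Finset.prod_biUnion ((pairwiseDisjoint_edgeComps S).subset (by exact_mod_cast h𝒜))]
  rfl

/-- The bridge from pairs (template, labeling) to edge sets: the monomial sees only the edges of
`G[π]`. -/
lemma monoP_eq_mono {r : ℕ} {G : SimpleGraph (Fin r)} {π : Fin r ↪ Fin n}
    {S : Finset (NodePair n)} (h : G.map π = graphOf S) (A : NodePair n → Bool) :
    M.monoP G π A = M.mono S A := by
  classical
  have hedge : ∀ e : Sym2 (Fin n), e ∈ (G.map π).edgeSet ↔ ∃ e' ∈ S, e'.1 = e := by
    intro e
    rw [h, edgeSet_graphOf]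
    simp
  unfold monoP mono
  have hmem : ∀ e ∈ G.edgeFinset, e.map π ∈ (G.map π).edgeSet := by
    intro e he
    rw [SimpleGraph.edgeSet_map]
    exact ⟨e, SimpleGraph.mem_edgeFinset.1 he, rfl⟩
  have hdiag : ∀ e ∈ G.edgeFinset, ¬ (e.map π).IsDiag := fun e he =>
    (G.map π).not_isDiag_of_mem_edgeSet (hmem e he)
  refine Finset.prod_bij (fun e he => ⟨e.map π, hdiag e he⟩) ?_ ?_ ?_ ?_
  · intro e he
    obtain ⟨e', he', h'⟩ := (hedge _).1 (hmem e he)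
    have : (⟨e.map π, hdiag e he⟩ : NodePair n) = e' := Subtype.ext h'.symm
    rwa [this]
  · intro e he e' he' hee
    exact Sym2.map.injective π.injective (congrArg Subtype.val hee)
  · intro e he
    have := (hedge e.1).2 ⟨e, he, rfl⟩
    rw [SimpleGraph.edgeSet_map] at this
    obtain ⟨e', he', hee⟩ := this
    exact ⟨e', SimpleGraph.mem_edgeFinset.2 he', Subtype.ext hee⟩
  · intro e he
    simp [centered, hdiag e he]

/-- The bound on the first moments, for labeled graphs. -/
lemma abs_integral_mono_le {D k : ℕ} {lam cm : ℝ} (hn : n ≠ 0) (h : M.CMoment D k lam cm)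
    {S : Finset (NodePair n)} (hS : S.card ≤ D) :
    |∫ A, M.mono S A ∂M.law| ≤
      ((D : ℝ) ^ cm * lam) ^ S.card * ((D : ℝ) ^ cm * (k / n)) ^ edgeRank S := by
  have := M.law_isProbabilityMeasure hn
  rcases S.eq_empty_or_nonempty with rfl | hne
  · simp [mono_empty, edgeRank_empty]
  obtain ⟨r, G, π, hG, hiso, hc, hr, -⟩ := exists_template S
  have h1 := h ⟨r, G⟩ ⟨hiso, by simpa [hc] using hne.card_pos, by simpa [hc] using hS⟩ π
  simp only [M.monoP_eq_mono hG, hc, hr] at h1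
  exact h1

/-- The bound on the mixed second moments, for labeled graphs. -/
lemma abs_integral_mono_mul_mono_le {D k : ℕ} {lam cm cv1 cv2 cv3 cv4 : ℝ} (hn : n ≠ 0)
    (hD : 2 ≤ D) (hcm : 0 ≤ cm) (hcv1 : 0 ≤ cv1) (hcv2 : 0 ≤ cv2)
    (hΘ : ∀ a b, M.Θ a b ∈ Set.Icc 0 lam) (hm : M.CMoment D k lam cm)
    (hv : M.CVariance D k lam cv1 cv2 cv3 cv4) {S T : Finset (NodePair n)} (hS : S.card ≤ D)
    (hT : T.card ≤ D) :
    |∫ A, M.mono S A * M.mono T A ∂M.law| ≤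
      (1 + cv2) * ((D : ℝ) ^ (cm + cv1) * lam) ^ (symmDiff S T).card *
        M.pbar lam ^ (S ∩ T).card *
        ((D : ℝ) ^ (cm + cv1) * (k / n)) ^ edgeRank (symmDiff S T) := by
  classical
  have := M.law_isProbabilityMeasure hn
  have hn0 : 0 < n := Nat.pos_of_ne_zero hn
  have hlam : 0 ≤ lam := (hΘ ⟨0, hn0⟩ ⟨0, hn0⟩).1.trans (hΘ ⟨0, hn0⟩ ⟨0, hn0⟩).2
  have hD1 : (1 : ℝ) ≤ D := by exact_mod_cast (by omega : 1 ≤ D)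
  have hpbar : 0 ≤ M.pbar lam := by
    rw [pbar_eq]
    have := M.qbar_pos
    have := M.q_le_half
    nlinarith
  have hkn : (0 : ℝ) ≤ k / n := by positivity
  have le1 : (D : ℝ) ^ cm ≤ (D : ℝ) ^ (cm + cv1) :=
    Real.rpow_le_rpow_of_exponent_le hD1 (by linarith)
  have le2 : (D : ℝ) ^ cv1 ≤ (D : ℝ) ^ (cm + cv1) :=
    Real.rpow_le_rpow_of_exponent_le hD1 (by linarith)
  have hm' : ∀ R : Finset (NodePair n), R.card ≤ D → |∫ A, M.mono R A ∂M.law| ≤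
      (1 + cv2) * ((D : ℝ) ^ (cm + cv1) * lam) ^ R.card *
        ((D : ℝ) ^ (cm + cv1) * (k / n)) ^ edgeRank R := by
    intro R hR
    refine (M.abs_integral_mono_le hn hm hR).trans ?_
    gcongr
    rw [← one_mul (((D : ℝ) ^ cm * lam) ^ R.card)]
    gcongr
    linarith
  -- Three cases escape part (1) of C-Variance and yet occur in the expansion: an empty factor,
  -- which is not a template and is left to C-Moment, and `S = T`, whose matching is perfect and
  -- which is left to the direct bound by `p̄`.
  rcases S.eq_empty_or_nonempty with rfl | hSne
  · have hΔ : symmDiff ∅ T = T := by simp [symmDiff]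
    rw [hΔ]
    simpa [mono_empty] using hm' T hT
  rcases T.eq_empty_or_nonempty with rfl | hTne
  · have hΔ : symmDiff S ∅ = S := by simp [symmDiff]
    rw [hΔ]
    simpa [mono_empty] using hm' S hS
  by_cases hST : S = T
  · subst hST
    have h2 := M.integral_mono_sq_mem hn hΘ S
    have h0 : (0 : ℝ) ≤ M.qbar ^ S.card := pow_nonneg M.qbar_pos.le _
    simp only [← pow_two, symmDiff_self, Finset.bot_eq_empty, Finset.card_empty, pow_zero,
      edgeRank_empty, mul_one, Finset.inter_self]
    rw [abs_of_nonneg (h0.trans h2.1)]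
    refine h2.2.trans ?_
    have := pow_nonneg hpbar S.card
    nlinarith
  obtain ⟨r₁, G₁, π₁, hG₁, hiso₁, hc₁, -, -⟩ := exists_template S
  obtain ⟨r₂, G₂, π₂, hG₂, hiso₂, hc₂, -, -⟩ := exists_template T
  -- For the matching induced by the labelings, perfection would force the two labeled graphs to
  -- coincide.
  have hperf : ¬ IsPerfectNodeMatching G₁ G₂ {x | π₁ x.1 = π₂ x.2} := by
    rintro ⟨hp₁, hp₂⟩
    have hadj : (graphOf S) = graphOf T := by
      rw [← hG₁, ← hG₂]
      ext a b
      rw [SimpleGraph.map_adj, SimpleGraph.map_adj]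
      constructor
      · rintro ⟨u, v, huv, rfl, rfl⟩
        obtain ⟨u', hu', h1, -⟩ := hp₁ u
        obtain ⟨v', hv', h2⟩ := h1 v huv
        exact ⟨u', v', h2, Eq.symm hu', Eq.symm hv'⟩
      · rintro ⟨u, v, huv, rfl, rfl⟩
        obtain ⟨u', hu', -, h1⟩ := hp₂ u
        obtain ⟨v', hv', h2⟩ := h1 v huv
        exact ⟨u', v', h2, hu', hv'⟩
    have := congrArg SimpleGraph.edgeSet hadj
    rw [edgeSet_graphOf, edgeSet_graphOf] at this
    exact hST (Finset.coe_injective (Subtype.val_injective.image_injective this))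
  have hmatch : IsNodeMatching {x : Fin r₁ × Fin r₂ | π₁ x.1 = π₂ x.2} := by
    intro v₁ v₂ w₁ w₂ hv hw
    simp only [Set.mem_ofPred_eq] at hv hw
    rw [← π₁.injective.eq_iff, hv, hw, π₂.injective.eq_iff]
  have hΔ : diffGraph G₁ G₂ π₁ π₂ = graphOf (symmDiff S T) := by
    rw [diffGraph, hG₁, hG₂]
    ext a b
    simp only [symmDiff, SimpleGraph.sup_adj, SimpleGraph.sdiff_adj, graphOf_adj]
    constructor
    · rintro (⟨⟨e, he, h⟩, h'⟩ | ⟨⟨e, he, h⟩, h'⟩)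
      · exact ⟨e, by simpa [he] using fun h₀ => h' ⟨e, h₀, h⟩, h⟩
      · exact ⟨e, by simpa [he] using fun h₀ => h' ⟨e, h₀, h⟩, h⟩
    · rintro ⟨e, he, h⟩
      have huniq : ∀ e' : NodePair n, e'.1 = s(a, b) → e' = e := fun e' h' =>
        Subtype.ext (h'.trans h.symm)
      rcases Finset.mem_union.1 he with he | he <;> rw [Finset.mem_sdiff] at he
      · refine Or.inl ⟨⟨e, he.1, h⟩, ?_⟩
        rintro ⟨e', he', h'⟩
        exact he.2 (huniq e' h' ▸ he')
      · refine Or.inr ⟨⟨e, he.1, h⟩, ?_⟩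
        rintro ⟨e', he', h'⟩
        exact he.2 (huniq e' h' ▸ he')
  have hI : interGraph G₁ G₂ π₁ π₂ = graphOf (S ∩ T) := by
    rw [interGraph, hG₁, hG₂]
    ext a b
    simp only [SimpleGraph.inf_adj, graphOf_adj, Finset.mem_inter]
    constructor
    · rintro ⟨⟨e, he, h⟩, ⟨e', he', h'⟩⟩
      obtain rfl : e = e' := Subtype.ext (h.trans h'.symm)
      exact ⟨e, ⟨he, he'⟩, h⟩
    · rintro ⟨e, ⟨he, he'⟩, h⟩
      exact ⟨⟨e, he, h⟩, ⟨e, he', h⟩⟩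
  have hmain := hv.1 ⟨r₁, G₁⟩ ⟨r₂, G₂⟩ ⟨hiso₁, by simpa [hc₁] using hSne.card_pos, by simpa [hc₁]⟩
    ⟨hiso₂, by simpa [hc₂] using hTne.card_pos, by simpa [hc₂]⟩ _ hmatch hperf π₁ π₂
    (fun v₁ v₂ => Iff.rfl)
  dsimp only at hmain
  generalize diffGraph G₁ G₂ π₁ π₂ = GΔ at hmain hΔ
  subst hΔ
  simp only [hI, M.monoP_eq_mono hG₁, M.monoP_eq_mono hG₂, ncard_edgeSet_graphOf] at hmain
  refine hmain.trans ?_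
  change cv2 * ((D : ℝ) ^ cv1 * lam) ^ _ * _ * ((D : ℝ) ^ cv1 * (k / n)) ^ edgeRank _ ≤ _
  have := pow_nonneg hpbar (S ∩ T).card
  gcongr
  linarith

end LatentGraphModel

/-! ### Nodes and edges paid for by the pieces of the expansion. -/

section Combinatorics

variable {n : ℕ}

lemma exists_mem_edgeComps_edgeSupp {S : Finset (NodePair n)} {v : Fin n}
    (hv : v ∈ edgeSupp S) : ∃ C ∈ edgeComps S, v ∈ edgeSupp C := by
  obtain ⟨e, he, hve⟩ := mem_edgeSupp.1 hv
  obtain ⟨C, hC, heC⟩ := exists_mem_edgeComps he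
  exact ⟨C, hC, mem_edgeSupp.2 ⟨e, heC, hve⟩⟩

/-- A path of `C` towards an endpoint of `T` uses only edges outside `T` until it reaches the first
endpoint of `T`. -/
lemma exists_reachable_edgeSupp {C T X : Finset (NodePair n)} (hX : ∀ e ∈ C, e ∉ T → e ∈ X)
    {v w : Fin n} (h : (graphOf C).Reachable v w) (hw : w ∈ edgeSupp T) (hv : v ∈ edgeSupp C)
    (hvX : v ∈ edgeSupp X) :
    ∃ u ∈ edgeSupp X, u ∈ edgeSupp C ∧ u ∈ edgeSupp T ∧ (graphOf X).Reachable v u := by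
  obtain ⟨p⟩ := h
  induction p with
  | nil => exact ⟨_, hvX, hv, hw, SimpleGraph.Reachable.refl _⟩
  | @cons a b c hab p ih =>
    by_cases ha : a ∈ edgeSupp T
    · exact ⟨a, hvX, hv, ha, SimpleGraph.Reachable.refl _⟩
    obtain ⟨e, he, hab'⟩ := graphOf_adj.1 hab
    have heX : e ∈ X := hX e he fun heT => ha (mem_edgeSupp.2 ⟨e, heT, by simp [hab']⟩)
    obtain ⟨u, h1, h2, h3, h4⟩ := ih hw (mem_edgeSupp.2 ⟨e, he, by simp [hab']⟩)
      (mem_edgeSupp.2 ⟨e, heX, by simp [hab']⟩)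
    exact ⟨u, h1, h2, h3, (graphOf_adj.2 ⟨e, heX, hab'⟩).reachable.trans h4⟩

/-- Every connected component of `S` meets the endpoints of `T`, and conversely. -/
def Linked (S T : Finset (NodePair n)) : Prop :=
  (∀ C ∈ edgeComps S, ∃ v ∈ edgeSupp C, v ∈ edgeSupp T) ∧
    ∀ C ∈ edgeComps T, ∃ v ∈ edgeSupp C, v ∈ edgeSupp S

lemma Linked.symm {S T : Finset (NodePair n)} (h : Linked S T) : Linked T S := ⟨h.2, h.1⟩

lemma Linked.refl (S : Finset (NodePair n)) : Linked S S := by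
  have : ∀ C ∈ edgeComps S, ∃ v ∈ edgeSupp C, v ∈ edgeSupp S := by
    intro C hC
    obtain ⟨v, hv⟩ := edgeSupp_nonempty (nonempty_of_mem_edgeComps hC)
    exact ⟨v, hv, edgeSupp_mono (subset_of_mem_edgeComps hC) hv⟩
  exact ⟨this, this⟩

open Classical in
-- The edge at `v` lies in a kept component of `S`, which meets `V(T)`. Walking there, no edge
-- before the first node of `V(T)` belongs to `T`, so these edges all survive in `X`.
lemma exists_reachable_symmDiff {S T : Finset (NodePair n)}
    {𝒜 ℬ : Finset (Finset (NodePair n))} (h𝒜 : 𝒜 ⊆ edgeComps S) (hℬ : ℬ ⊆ edgeComps T)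
    (hST : ∀ C ∈ edgeComps S, ∃ v ∈ edgeSupp C, v ∈ edgeSupp T) {X : Finset (NodePair n)}
    (hX : X = symmDiff (𝒜.biUnion id) (ℬ.biUnion id)) {v : Fin n} (hv : v ∈ edgeSupp X)
    (hvT : v ∉ edgeSupp T) :
    ∃ u ∈ edgeSupp X, u ∈ edgeSupp S ∧ u ∈ edgeSupp T ∧ (graphOf X).Reachable v u := by
  obtain ⟨e, he, hve⟩ := mem_edgeSupp.1 hv
  have hL : ∀ e ∈ ℬ.biUnion id, e ∈ T := by
    intro e he
    obtain ⟨C, hC, he⟩ := Finset.mem_biUnion.1 he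
    exact subset_of_mem_edgeComps (hℬ hC) he
  have heT : e ∉ ℬ.biUnion id := fun h => hvT (mem_edgeSupp.2 ⟨e, hL e h, hve⟩)
  have heK : e ∈ 𝒜.biUnion id := by
    rw [hX, Finset.mem_symmDiff] at he
    tauto
  obtain ⟨C, hC, heC⟩ := Finset.mem_biUnion.1 heK
  obtain ⟨w, hw, hwT⟩ := hST C (h𝒜 hC)
  have hvC : v ∈ edgeSupp C := mem_edgeSupp.2 ⟨e, heC, hve⟩
  obtain ⟨u, h1, h2, h3, h4⟩ := exists_reachable_edgeSupp (X := X) (fun e he heT => by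
    rw [hX, Finset.mem_symmDiff]
    exact Or.inl ⟨Finset.mem_biUnion.2 ⟨C, hC, he⟩, fun h => heT (hL e h)⟩)
    (reachable_of_mem_edgeComps (h𝒜 hC) hvC hw) hwT hvC hv
  exact ⟨u, h1, edgeSupp_mono (subset_of_mem_edgeComps (h𝒜 hC)) h2, h3, h4⟩

open Classical in
-- The component of such a node is either dropped, or kept; in the latter case its edges at `v`
-- cannot be cancelled by `ℬ`, as `v` is not an endpoint of `T`.
lemma mem_edgeSupp_symmDiff_or {S T : Finset (NodePair n)}
    {𝒜 ℬ : Finset (Finset (NodePair n))} (hℬ : ℬ ⊆ edgeComps T) {v : Fin n}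
    (hv : v ∈ edgeSupp S) (hvT : v ∉ edgeSupp T) :
    v ∈ edgeSupp (symmDiff (𝒜.biUnion id) (ℬ.biUnion id)) ∨
      ∃ C ∈ edgeComps S \ 𝒜, v ∈ edgeSupp C := by
  obtain ⟨C, hC, hvC⟩ := exists_mem_edgeComps_edgeSupp hv
  by_cases hC𝒜 : C ∈ 𝒜
  · left
    obtain ⟨e, he, hve⟩ := mem_edgeSupp.1 hvC
    refine mem_edgeSupp.2 ⟨e, ?_, hve⟩
    rw [Finset.mem_symmDiff]
    refine Or.inl ⟨Finset.mem_biUnion.2 ⟨C, hC𝒜, he⟩, fun h => ?_⟩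
    obtain ⟨C', hC', he'⟩ := Finset.mem_biUnion.1 h
    exact hvT (mem_edgeSupp.2 ⟨e, subset_of_mem_edgeComps (hℬ hC') he', hve⟩)
  · exact Or.inr ⟨C, Finset.mem_sdiff.2 ⟨hC, hC𝒜⟩, hvC⟩

open Classical in
/-- The number of nodes of exactly one of two linked graphs is bounded by the total rank of the
pieces appearing in the expansion of the product of the two centered monomials. -/
lemma card_symmDiff_edgeSupp_le {S T : Finset (NodePair n)} (hST : Linked S T)
    {𝒜 ℬ : Finset (Finset (NodePair n))} (h𝒜 : 𝒜 ⊆ edgeComps S) (hℬ : ℬ ⊆ edgeComps T) :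
    (symmDiff (edgeSupp S) (edgeSupp T)).card ≤
      edgeRank (symmDiff (𝒜.biUnion id) (ℬ.biUnion id)) +
        (∑ C ∈ edgeComps S \ 𝒜, edgeRank C + ∑ C ∈ edgeComps T \ ℬ, edgeRank C) := by
  set U := symmDiff (edgeSupp S) (edgeSupp T) with hU
  obtain ⟨X, hX⟩ : ∃ X, X = symmDiff (𝒜.biUnion id) (ℬ.biUnion id) := ⟨_, rfl⟩
  have hX' : X = symmDiff (ℬ.biUnion id) (𝒜.biUnion id) := by rw [symmDiff_comm, hX]
  -- Linking provides a node of `C` common to both graphs, hence outside `U`; so `U` misses a node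
  -- of the connected set `C` and the rank bounds `|U ∩ V(C)|`.
  have hcomp : ∀ S T : Finset (NodePair n), U = symmDiff (edgeSupp S) (edgeSupp T) →
      (∀ C ∈ edgeComps S, ∃ v ∈ edgeSupp C, v ∈ edgeSupp T) →
      ∀ C ∈ edgeComps S, (U ∩ edgeSupp C).card ≤ edgeRank C := by
    intro S T hU hST C hC
    refine card_le_edgeRank Finset.inter_subset_right fun v hv => ?_
    obtain ⟨w, hw, hwT⟩ := hST C hC
    refine ⟨w, hw, fun h => ?_, reachable_of_mem_edgeComps hC hv hw⟩
    have := (Finset.mem_inter.1 h).1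
    rw [hU, Finset.mem_symmDiff] at this
    have := edgeSupp_mono (subset_of_mem_edgeComps hC) hw
    tauto
  have hΔ : (U ∩ edgeSupp X).card ≤ edgeRank X := by
    refine card_le_edgeRank Finset.inter_subset_right fun v hv => ?_
    have key : ∃ u ∈ edgeSupp X, u ∈ edgeSupp S ∧ u ∈ edgeSupp T ∧
        (graphOf X).Reachable v u := by
      by_cases hvT : v ∈ edgeSupp T
      · by_cases hvS : v ∈ edgeSupp S
        · exact ⟨v, hv, hvS, hvT, SimpleGraph.Reachable.refl _⟩
        · obtain ⟨u, h1, h2, h3, h4⟩ := exists_reachable_symmDiff hℬ h𝒜 hST.2 hX' hv hvS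
          exact ⟨u, h1, h3, h2, h4⟩
      · exact exists_reachable_symmDiff h𝒜 hℬ hST.1 hX hv hvT
    obtain ⟨u, h1, h2, h3, h4⟩ := key
    refine ⟨u, h1, fun h => ?_, h4⟩
    have := (Finset.mem_inter.1 h).1
    rw [hU, Finset.mem_symmDiff] at this
    tauto
  -- Every node of `U` is charged to the surviving difference `X` or to a dropped component.
  have hcov : U ⊆ (U ∩ edgeSupp X) ∪
      (((edgeComps S \ 𝒜).biUnion fun C => U ∩ edgeSupp C) ∪
        (edgeComps T \ ℬ).biUnion fun C => U ∩ edgeSupp C) := by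
    intro v hv
    simp only [Finset.mem_union, Finset.mem_inter, Finset.mem_biUnion]
    have hv' := hv
    rw [hU, Finset.mem_symmDiff] at hv'
    rcases hv' with ⟨h1, h2⟩ | ⟨h1, h2⟩
    · rcases mem_edgeSupp_symmDiff_or (𝒜 := 𝒜) hℬ h1 h2 with h | ⟨C, hC, h⟩
      · exact Or.inl ⟨hv, hX ▸ h⟩
      · exact Or.inr (Or.inl ⟨C, hC, hv, h⟩)
    · rcases mem_edgeSupp_symmDiff_or (𝒜 := ℬ) h𝒜 h1 h2 with h | ⟨C, hC, h⟩
      · exact Or.inl ⟨hv, hX' ▸ h⟩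
      · exact Or.inr (Or.inr ⟨C, hC, hv, h⟩)
  rw [← hX]
  refine (Finset.card_le_card hcov).trans ((Finset.card_union_le _ _).trans
    (Nat.add_le_add hΔ ((Finset.card_union_le _ _).trans (Nat.add_le_add ?_ ?_))))
  · exact Finset.card_biUnion_le.trans (Finset.sum_le_sum fun C hC =>
      hcomp S T hU hST.1 C (Finset.mem_sdiff.1 hC).1)
  · exact Finset.card_biUnion_le.trans (Finset.sum_le_sum fun C hC =>
      hcomp T S (by rw [hU, symmDiff_comm]) hST.2 C (Finset.mem_sdiff.1 hC).1)

lemma card_symmDiff_add {α : Type*} [DecidableEq α] (K L : Finset α) :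
    (symmDiff K L).card + 2 * (K ∩ L).card = K.card + L.card := by
  have h1 := Finset.card_sdiff_add_card_inter K L
  have h2 := Finset.card_sdiff_add_card_inter L K
  have h3 : (symmDiff K L).card = (K \ L).card + (L \ K).card :=
    Finset.card_union_of_disjoint (disjoint_sdiff_sdiff)
  rw [Finset.inter_comm] at h2
  omega

open Classical in
lemma card_biUnion_add_sum {S : Finset (NodePair n)} {𝒜 : Finset (Finset (NodePair n))}
    (h𝒜 : 𝒜 ⊆ edgeComps S) :
    (𝒜.biUnion id).card + ∑ C ∈ edgeComps S \ 𝒜, C.card = S.card := by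
  rw [← sum_card_edgeComps S, ← Finset.sum_sdiff h𝒜, add_comm, Finset.card_biUnion
    ((pairwiseDisjoint_edgeComps S).subset (by exact_mod_cast h𝒜))]
  rfl

open Classical in
lemma biUnion_subset_of_edgeComps {S : Finset (NodePair n)} {𝒜 : Finset (Finset (NodePair n))}
    (h𝒜 : 𝒜 ⊆ edgeComps S) : 𝒜.biUnion id ⊆ S :=
  Finset.biUnion_subset.2 fun _ hC => subset_of_mem_edgeComps (h𝒜 hC)

lemma card_sdiff_edgeComps_le {S : Finset (NodePair n)} {𝒞 : Finset (Finset (NodePair n))}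
    (h𝒞 : 𝒞 ⊆ edgeComps S) : 𝒞.card ≤ ∑ C ∈ 𝒞, C.card := by
  rw [Finset.card_eq_sum_ones]
  exact Finset.sum_le_sum fun C hC => (nonempty_of_mem_edgeComps (h𝒞 hC)).card_pos

open Classical in
-- An edge of exactly one of `S`, `T` either lies in a dropped component or is kept on its side with
-- nothing to cancel it.
lemma card_symmDiff_le_expansion {S T : Finset (NodePair n)}
    {𝒜 ℬ : Finset (Finset (NodePair n))} (h𝒜 : 𝒜 ⊆ edgeComps S) (hℬ : ℬ ⊆ edgeComps T) :
    (symmDiff S T).card ≤ (symmDiff (𝒜.biUnion id) (ℬ.biUnion id)).card +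
      (∑ C ∈ edgeComps S \ 𝒜, C.card + ∑ C ∈ edgeComps T \ ℬ, C.card) := by
  have hK := biUnion_subset_of_edgeComps h𝒜
  have hL := biUnion_subset_of_edgeComps hℬ
  have h1 := card_biUnion_add_sum h𝒜
  have h2 := card_biUnion_add_sum hℬ
  set K := 𝒜.biUnion id
  set L := ℬ.biUnion id
  have hsub : symmDiff S T ⊆ symmDiff K L ∪ ((S \ K) ∪ (T \ L)) := by
    intro e
    have := @hK e
    have := @hL e
    simp only [Finset.mem_symmDiff, Finset.mem_union, Finset.mem_sdiff]
    tauto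
  have h3 := (Finset.card_le_card hsub).trans ((Finset.card_union_le _ _).trans
    (Nat.add_le_add_left (Finset.card_union_le _ _) _))
  rw [Finset.card_sdiff_of_subset hK, Finset.card_sdiff_of_subset hL] at h3
  omega

end Combinatorics

/-! ### Expansion of the centered monomials and exact orthogonality. -/

namespace LatentGraphModel

variable {n : ℕ} (M : LatentGraphModel n)

/-- The product over the connected components of the centered monomials. -/
def monoBar (S : Finset (NodePair n)) (A : NodePair n → Bool) : ℝ :=
  ∏ C ∈ edgeComps S, (M.mono C A - ∫ B, M.mono C B ∂M.law)

open Classical in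
-- Here `𝒜` is the set of components whose monomial is kept, the others giving minus their mean. A
-- general `𝒞` is allowed because the orthogonality argument expands all components but one.
lemma prod_mono_sub_eq_sum {S : Finset (NodePair n)} {𝒞 : Finset (Finset (NodePair n))}
    (h𝒞 : 𝒞 ⊆ edgeComps S) (A : NodePair n → Bool) :
    ∏ C ∈ 𝒞, (M.mono C A - ∫ B, M.mono C B ∂M.law) =
      ∑ 𝒜 ∈ 𝒞.powerset, M.mono (𝒜.biUnion id) A *
        ∏ C ∈ 𝒞 \ 𝒜, (-∫ B, M.mono C B ∂M.law) := by
  simp only [sub_eq_add_neg]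
  rw [Finset.prod_add]
  refine Finset.sum_congr rfl fun 𝒜 h => ?_
  rw [M.prod_mono_eq ((Finset.mem_powerset.1 h).trans h𝒞)]

open Classical in
-- `R` and `R'` may overlap, so their product is not a monomial; it is still a product of
-- single-edge functions over `R ∪ R'`, to which independence applies.
lemma integral_mul_mono_of_disjoint (hn : n ≠ 0) {C R R' : Finset (NodePair n)}
    (h : Disjoint (edgeSupp C) (edgeSupp (R ∪ R'))) :
    ∫ A, M.mono C A * (M.mono R A * M.mono R' A) ∂M.law =
      (∫ A, M.mono C A ∂M.law) * ∫ A, M.mono R A * M.mono R' A ∂M.law := by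
  have := M.integral_law_mul_of_disjoint hn h (fun _ b => (if b then 1 else 0) - M.q)
    (fun e b => (if e ∈ R then ((if b then 1 else 0) - M.q) else 1) *
      (if e ∈ R' then ((if b then 1 else 0) - M.q) else 1))
  simpa only [mono, Finset.prod_mul_distrib, Finset.prod_ite_mem, Finset.union_inter_cancel_left,
    Finset.union_inter_cancel_right] using this

/-- If a connected component of `S` does not meet `T`, then the centered monomials are
orthogonal. -/
lemma integral_monoBar_mul_eq_zero (hn : n ≠ 0) {S T C : Finset (NodePair n)}
    (hC : C ∈ edgeComps S) (hCT : Disjoint (edgeSupp C) (edgeSupp T)) :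
    ∫ A, M.monoBar S A * M.monoBar T A ∂M.law = 0 := by
  classical
  have := M.law_isProbabilityMeasure hn
  have herase : (edgeComps S).erase C ⊆ edgeComps S := Finset.erase_subset _ _
  -- The factor of the isolated component `C` is left unexpanded, so each term is the covariance of
  -- `mono C` with monomials on other nodes.
  have hexp : ∀ A, M.monoBar S A * M.monoBar T A =
      ∑ 𝒜 ∈ ((edgeComps S).erase C).powerset, ∑ ℬ ∈ (edgeComps T).powerset,
        ((M.mono C A * (M.mono (𝒜.biUnion id) A * M.mono (ℬ.biUnion id) A) -
          (∫ B, M.mono C B ∂M.law) * (M.mono (𝒜.biUnion id) A * M.mono (ℬ.biUnion id) A)) *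
        ((∏ C' ∈ (edgeComps S).erase C \ 𝒜, (-∫ B, M.mono C' B ∂M.law)) *
          ∏ C' ∈ edgeComps T \ ℬ, (-∫ B, M.mono C' B ∂M.law))) := by
    intro A
    unfold monoBar
    rw [← Finset.mul_prod_erase _ _ hC, M.prod_mono_sub_eq_sum herase,
      M.prod_mono_sub_eq_sum (Finset.Subset.refl _), mul_assoc, Finset.sum_mul_sum,
      Finset.mul_sum]
    refine Finset.sum_congr rfl fun 𝒜 _ => ?_
    rw [Finset.mul_sum]
    exact Finset.sum_congr rfl fun ℬ _ => by ring
  simp only [hexp]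
  rw [integral_finsetSum _ fun _ _ => Integrable.of_finite]
  refine Finset.sum_eq_zero fun 𝒜 h𝒜 => ?_
  rw [integral_finsetSum _ fun _ _ => Integrable.of_finite]
  refine Finset.sum_eq_zero fun ℬ hℬ => ?_
  rw [integral_mul_const, integral_sub Integrable.of_finite Integrable.of_finite,
    integral_const_mul, M.integral_mul_mono_of_disjoint hn, sub_self, zero_mul]
  rw [Finset.disjoint_left]
  intro v hv hv'
  obtain ⟨e, he, hve⟩ := mem_edgeSupp.1 hv'
  rcases Finset.mem_union.1 he with he | he
  · obtain ⟨C', hC', heC'⟩ := Finset.mem_biUnion.1 he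
    have hC'' := Finset.mem_erase.1 (Finset.mem_powerset.1 h𝒜 hC')
    exact hC''.1 (eq_of_mem_edgeSupp hC hC''.2 hv (mem_edgeSupp.2 ⟨e, heC', hve⟩)).symm
  · refine Finset.disjoint_left.1 hCT hv (mem_edgeSupp.2 ⟨e, ?_, hve⟩)
    exact biUnion_subset_of_edgeComps (Finset.mem_powerset.1 hℬ) he

lemma integral_monoBar_mul_eq_zero_of_not_linked (hn : n ≠ 0) {S T : Finset (NodePair n)}
    (h : ¬ Linked S T) : ∫ A, M.monoBar S A * M.monoBar T A ∂M.law = 0 := by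
  rw [Linked, not_and_or] at h
  push Not at h
  rcases h with ⟨C, hC, h⟩ | ⟨C, hC, h⟩
  · exact M.integral_monoBar_mul_eq_zero hn hC (Finset.disjoint_left.2 h)
  · simp only [mul_comm (M.monoBar S _)]
    exact M.integral_monoBar_mul_eq_zero hn hC (Finset.disjoint_left.2 h)

end LatentGraphModel

/-! ### Bounds on the entries of the Gram matrix. -/

namespace LatentGraphModel

variable {n : ℕ} (M : LatentGraphModel n)

open Classical in
/-- The generic term of the expansion of `𝔼[P̄_S P̄_T]`. -/
def expansionTerm (S T : Finset (NodePair n)) (𝒜 ℬ : Finset (Finset (NodePair n))) : ℝ :=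
  (∫ A, M.mono (𝒜.biUnion id) A * M.mono (ℬ.biUnion id) A ∂M.law) *
    ((∏ C ∈ edgeComps S \ 𝒜, (-∫ B, M.mono C B ∂M.law)) *
      ∏ C ∈ edgeComps T \ ℬ, (-∫ B, M.mono C B ∂M.law))

lemma integral_monoBar_mul_eq_sum (hn : n ≠ 0) (S T : Finset (NodePair n)) :
    ∫ A, M.monoBar S A * M.monoBar T A ∂M.law =
      ∑ x ∈ (edgeComps S).powerset ×ˢ (edgeComps T).powerset, M.expansionTerm S T x.1 x.2 := by
  classical
  have := M.law_isProbabilityMeasure hn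
  have hexp : ∀ A, M.monoBar S A * M.monoBar T A =
      ∑ x ∈ (edgeComps S).powerset ×ˢ (edgeComps T).powerset,
        (M.mono (x.1.biUnion id) A * M.mono (x.2.biUnion id) A) *
        ((∏ C ∈ edgeComps S \ x.1, (-∫ B, M.mono C B ∂M.law)) *
          ∏ C ∈ edgeComps T \ x.2, (-∫ B, M.mono C B ∂M.law)) := by
    intro A
    unfold monoBar
    rw [M.prod_mono_sub_eq_sum (Finset.Subset.refl _),
      M.prod_mono_sub_eq_sum (Finset.Subset.refl _), Finset.sum_mul_sum, Finset.sum_product]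
    exact Finset.sum_congr rfl fun 𝒜 _ => Finset.sum_congr rfl fun ℬ _ => by ring
  simp only [hexp]
  rw [integral_finsetSum _ fun _ _ => Integrable.of_finite]
  exact Finset.sum_congr rfl fun x _ => integral_mul_const _ _

/-- The bounds on the moments of the monomials with at most `D` edges on which the proof of the
near-orthogonality relies: `a` is the price of an unmatched edge, `b` of a unit of rank, and `y` the
resulting small parameter. -/
structure MomentBounds (D : ℕ) (K a b pb y : ℝ) : Prop where
  n_ne_zero : n ≠ 0
  one_le_K : 1 ≤ K
  a_nonneg : 0 ≤ a
  b_nonneg : 0 ≤ b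
  y_nonneg : 0 ≤ y
  y_le_one : y ≤ 1
  moment : ∀ S : Finset (NodePair n), S.card ≤ D →
    |∫ A, M.mono S A ∂M.law| ≤ a ^ S.card * b ^ edgeRank S
  moment₂ : open Classical in ∀ S T : Finset (NodePair n), S.card ≤ D → T.card ≤ D →
    |∫ A, M.mono S A * M.mono T A ∂M.law| ≤
      K * a ^ (symmDiff S T).card * pb ^ (S ∩ T).card * b ^ edgeRank (symmDiff S T)
  edge_small : a ≤ y ^ 2 * √M.qbar
  rank_small : a * b * √n ≤ y ^ 2 * √M.qbar
  pb_nonneg : 0 ≤ pb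
  pb_pow_le : ∀ i ≤ D, pb ^ i ≤ 2 * M.qbar ^ i

variable {M}

/-- Since `U ≤ v ≤ e`, the factors group into `U` blocks `a * b * √n`, `v - U` blocks `a * b` and `e
- v` blocks `a`, each at most `y ^ 2 * √q̄`. -/
lemma MomentBounds.weight_le {D : ℕ} {K a b pb y : ℝ} (h : M.MomentBounds D K a b pb y)
    {e v U i : ℕ} (hUv : U ≤ v) (hve : v ≤ e) (hi : i ≤ D) :
    K * a ^ e * pb ^ i * b ^ v * √n ^ U ≤ 2 * K * y ^ (2 * e) * √M.qbar ^ (e + 2 * i) := by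
  obtain ⟨w, rfl⟩ := Nat.exists_eq_add_of_le hUv
  obtain ⟨f, rfl⟩ := Nat.exists_eq_add_of_le hve
  have hK := h.one_le_K
  have ha := h.a_nonneg
  have hb := h.b_nonneg
  have hy := h.y_nonneg
  have hn1 : (1 : ℝ) ≤ √n := by
    rw [Real.one_le_sqrt]
    exact_mod_cast Nat.pos_of_ne_zero h.n_ne_zero
  have h1 : a * b ≤ y ^ 2 * √M.qbar := by
    refine le_trans ?_ h.rank_small
    exact le_mul_of_one_le_right (mul_nonneg ha hb) hn1
  have hsq : √M.qbar ^ (2 * i) = M.qbar ^ i := by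
    rw [pow_mul, Real.sq_sqrt M.qbar_pos.le]
  have key : a ^ (U + w + f) * b ^ (U + w) * √n ^ U ≤ (y ^ 2 * √M.qbar) ^ (U + w + f) := by
    calc a ^ (U + w + f) * b ^ (U + w) * √n ^ U
        = (a * b * √n) ^ U * (a * b) ^ w * a ^ f := by ring
      _ ≤ (y ^ 2 * √M.qbar) ^ U * (y ^ 2 * √M.qbar) ^ w * (y ^ 2 * √M.qbar) ^ f := by
          have := h.rank_small
          have := h.edge_small
          gcongr
      _ = _ := by ring
  have hpb := h.pb_pow_le i hi
  calc K * a ^ (U + w + f) * pb ^ i * b ^ (U + w) * √n ^ U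
      = K * pb ^ i * (a ^ (U + w + f) * b ^ (U + w) * √n ^ U) := by ring
    _ ≤ K * (2 * M.qbar ^ i) * (y ^ 2 * √M.qbar) ^ (U + w + f) := by
        have := h.pb_nonneg
        have := M.qbar_pos
        gcongr
    _ = _ := by rw [pow_add _ (U + w + f) (2 * i), hsq]; ring

lemma MomentBounds.prod_le {D : ℕ} {K a b pb y : ℝ} (h : M.MomentBounds D K a b pb y)
    {S : Finset (NodePair n)} (hS : S.card ≤ D) {𝒞 : Finset (Finset (NodePair n))}
    (h𝒞 : 𝒞 ⊆ edgeComps S) :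
    |∏ C ∈ 𝒞, (-∫ B, M.mono C B ∂M.law)| ≤
      a ^ (∑ C ∈ 𝒞, C.card) * b ^ (∑ C ∈ 𝒞, edgeRank C) := by
  rw [Finset.abs_prod, ← Finset.prod_pow_eq_pow_sum, ← Finset.prod_pow_eq_pow_sum,
    ← Finset.prod_mul_distrib]
  refine Finset.prod_le_prod (fun _ _ => abs_nonneg _) fun C hC => ?_
  rw [abs_neg]
  exact h.moment C ((Finset.card_le_card (subset_of_mem_edgeComps (h𝒞 hC))).trans hS)

open Classical in
-- The ranks of the pieces add up to at least the number of factors `√n`. One half of the gain `y ^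
-- (2 * e)` pays for `S ∆ T`; the other half leaves a factor `y` per dropped component, which makes
-- the sum over expansions harmless.
lemma MomentBounds.expansionTerm_le {D : ℕ} {K a b pb y : ℝ} (h : M.MomentBounds D K a b pb y)
    {S T : Finset (NodePair n)} (hS : S.card ≤ D) (hT : T.card ≤ D) (hST : Linked S T)
    {𝒜 ℬ : Finset (Finset (NodePair n))} (h𝒜 : 𝒜 ⊆ edgeComps S) (hℬ : ℬ ⊆ edgeComps T) :
    |M.expansionTerm S T 𝒜 ℬ| * √n ^ (symmDiff (edgeSupp S) (edgeSupp T)).card ≤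
      2 * K * y ^ (symmDiff S T).card * √M.qbar ^ (S.card + T.card) *
        (y ^ (edgeComps S \ 𝒜).card * y ^ (edgeComps T \ ℬ).card) := by
  have hU := card_symmDiff_edgeSupp_le hST h𝒜 hℬ
  have hd := card_symmDiff_le_expansion h𝒜 hℬ
  have hKc := card_biUnion_add_sum h𝒜
  have hLc := card_biUnion_add_sum hℬ
  have hKS := biUnion_subset_of_edgeComps h𝒜
  have hLT := biUnion_subset_of_edgeComps hℬ
  unfold expansionTerm
  set K' := 𝒜.biUnion id
  set L' := ℬ.biUnion id
  have hP := h.prod_le hS (Finset.sdiff_subset (s := edgeComps S) (t := 𝒜))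
  have hQ := h.prod_le hT (Finset.sdiff_subset (s := edgeComps T) (t := ℬ))
  have hr₁ := card_sdiff_edgeComps_le (Finset.sdiff_subset (s := edgeComps S) (t := 𝒜))
  have hr₂ := card_sdiff_edgeComps_le (Finset.sdiff_subset (s := edgeComps T) (t := ℬ))
  have hv₁ : ∑ C ∈ edgeComps S \ 𝒜, edgeRank C ≤ ∑ C ∈ edgeComps S \ 𝒜, C.card :=
    Finset.sum_le_sum fun C _ => edgeRank_le_card C
  have hv₂ : ∑ C ∈ edgeComps T \ ℬ, edgeRank C ≤ ∑ C ∈ edgeComps T \ ℬ, C.card :=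
    Finset.sum_le_sum fun C _ => edgeRank_le_card C
  have hv₃ := edgeRank_le_card (symmDiff K' L')
  have hm := h.moment₂ K' L' ((Finset.card_le_card hKS).trans hS)
    ((Finset.card_le_card hLT).trans hT)
  have hcard := card_symmDiff_add K' L'
  have hi : (K' ∩ L').card ≤ D :=
    (Finset.card_le_card (Finset.inter_subset_left.trans hKS)).trans hS
  generalize ∑ C ∈ edgeComps S \ 𝒜, C.card = e₁ at *
  generalize ∑ C ∈ edgeComps T \ ℬ, C.card = e₂ at *
  generalize ∑ C ∈ edgeComps S \ 𝒜, edgeRank C = v₁ at *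
  generalize ∑ C ∈ edgeComps T \ ℬ, edgeRank C = v₂ at *
  generalize edgeRank (symmDiff K' L') = v₀ at *
  generalize hkl : (symmDiff K' L').card = e₀ at *
  generalize hii : (K' ∩ L').card = i at *
  have hw := h.weight_le hU (show v₀ + (v₁ + v₂) ≤ e₀ + (e₁ + e₂) by omega) hi
  have hK := h.one_le_K
  have ha := h.a_nonneg
  have hb := h.b_nonneg
  have hy := h.y_nonneg
  have hpb := h.pb_nonneg
  rw [abs_mul, abs_mul]
  calc _ ≤ (K * a ^ e₀ * pb ^ i * b ^ v₀) * ((a ^ e₁ * b ^ v₁) * (a ^ e₂ * b ^ v₂)) *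
        √n ^ (symmDiff (edgeSupp S) (edgeSupp T)).card := by gcongr
    _ = K * a ^ (e₀ + (e₁ + e₂)) * pb ^ i * b ^ (v₀ + (v₁ + v₂)) *
        √n ^ (symmDiff (edgeSupp S) (edgeSupp T)).card := by ring
    _ ≤ _ := hw
    _ ≤ 2 * K * y ^ ((symmDiff S T).card +
          ((edgeComps S \ 𝒜).card + (edgeComps T \ ℬ).card)) *
        √M.qbar ^ (S.card + T.card) := by
        rw [show e₀ + (e₁ + e₂) + 2 * i = S.card + T.card by omega]
        -- The total number of unmatched or dropped edges dominates both `|S ∆ T|` and the number of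
        -- dropped components, each having an edge; hence the factor 2.
        have := pow_le_pow_of_le_one hy h.y_le_one (show (symmDiff S T).card +
          ((edgeComps S \ 𝒜).card + (edgeComps T \ ℬ).card) ≤ 2 * (e₀ + (e₁ + e₂)) by omega)
        gcongr
    _ = _ := by ring

lemma sum_powerset_pow_card_sdiff {α : Type*} [DecidableEq α] (s : Finset α) (y : ℝ) :
    ∑ t ∈ s.powerset, y ^ (s \ t).card = (1 + y) ^ s.card := by
  rw [← Finset.prod_const, Finset.prod_add]
  simp

lemma MomentBounds.sum_le {D : ℕ} {K a b pb y : ℝ} (h : M.MomentBounds D K a b pb y)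
    {S T : Finset (NodePair n)} (hS : S.card ≤ D) (hT : T.card ≤ D) :
    (open Classical in ∑ x ∈ (edgeComps S).powerset ×ˢ (edgeComps T).powerset,
      y ^ (edgeComps S \ x.1).card * y ^ (edgeComps T \ x.2).card) ≤ (1 + y) ^ (2 * D) := by
  classical
  rw [Finset.sum_product]
  dsimp only
  rw [← Finset.sum_mul_sum, sum_powerset_pow_card_sdiff,
    sum_powerset_pow_card_sdiff, ← pow_add]
  refine pow_le_pow_right₀ (by linarith [h.y_nonneg]) ?_
  have := card_edgeComps_le S
  have := card_edgeComps_le T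
  omega

open Classical in
/-- The bound on the entries of the Gram matrix. -/
lemma MomentBounds.abs_integral_monoBar_mul_le {D : ℕ} {K a b pb y : ℝ}
    (h : M.MomentBounds D K a b pb y)
    {S T : Finset (NodePair n)} (hS : S.card ≤ D) (hT : T.card ≤ D) :
    |∫ A, M.monoBar S A * M.monoBar T A ∂M.law| *
        √n ^ (symmDiff (edgeSupp S) (edgeSupp T)).card ≤
      2 * K * (1 + y) ^ (2 * D) * y ^ (symmDiff S T).card * √M.qbar ^ (S.card + T.card) := by
  have hK := h.one_le_K
  have hy := h.y_nonneg
  -- The node count used for the expansion requires linked graphs; unlinked pairs are exactly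
  -- orthogonal.
  by_cases hST : Linked S T
  swap
  · rw [M.integral_monoBar_mul_eq_zero_of_not_linked h.n_ne_zero hST, abs_zero, zero_mul]
    positivity
  rw [M.integral_monoBar_mul_eq_sum h.n_ne_zero]
  calc _ ≤ (∑ x ∈ (edgeComps S).powerset ×ˢ (edgeComps T).powerset,
          |M.expansionTerm S T x.1 x.2|) *
          √n ^ (symmDiff (edgeSupp S) (edgeSupp T)).card := by
        gcongr
        exact Finset.abs_sum_le_sum_abs _ _
    _ ≤ ∑ x ∈ (edgeComps S).powerset ×ˢ (edgeComps T).powerset,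
        2 * K * y ^ (symmDiff S T).card * √M.qbar ^ (S.card + T.card) *
        (y ^ (edgeComps S \ x.1).card * y ^ (edgeComps T \ x.2).card) := by
        rw [Finset.sum_mul]
        refine Finset.sum_le_sum fun x hx => ?_
        rw [Finset.mem_product, Finset.mem_powerset, Finset.mem_powerset] at hx
        exact h.expansionTerm_le hS hT hST hx.1 hx.2
    _ ≤ 2 * K * y ^ (symmDiff S T).card * √M.qbar ^ (S.card + T.card) *
        (1 + y) ^ (2 * D) := by
        rw [← Finset.mul_sum]
        have := h.sum_le hS hT
        gcongr
    _ = _ := by ring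

/-- The bound on the diagonal entries of the Gram matrix. -/
lemma MomentBounds.abs_integral_monoBar_sq_sub_le {D : ℕ} {K a b pb y : ℝ}
    (h : M.MomentBounds D K a b pb y) {S : Finset (NodePair n)} (hS : S.card ≤ D) :
    |∫ A, M.monoBar S A * M.monoBar S A ∂M.law - ∫ A, M.mono S A ^ 2 ∂M.law| ≤
      2 * K * ((1 + y) ^ (2 * D) - 1) * M.qbar ^ S.card := by
  classical
  have hK := h.one_le_K
  have hy := h.y_nonneg
  have hq := M.qbar_pos
  set I := (edgeComps S).powerset ×ˢ (edgeComps S).powerset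
  -- Keeping every component on both sides produces the raw second moment. Removing this term
  -- removes the `1` from `(1 + y) ^ (2 * D)`, so the remainder is small.
  have htop : (edgeComps S, edgeComps S) ∈ I := by simp [I]
  have h1 : M.expansionTerm S S (edgeComps S) (edgeComps S) = ∫ A, M.mono S A ^ 2 ∂M.law := by
    simp only [expansionTerm, biUnion_edgeComps, sdiff_self, Finset.bot_eq_empty,
      Finset.prod_empty, mul_one, pow_two]
  have hsq : √M.qbar ^ (S.card + S.card) = M.qbar ^ S.card := by
    rw [← two_mul, pow_mul, Real.sq_sqrt M.qbar_pos.le]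
  rw [M.integral_monoBar_mul_eq_sum h.n_ne_zero, ← Finset.add_sum_erase _ _ htop, h1,
    add_sub_cancel_left]
  calc _ ≤ ∑ x ∈ I.erase (edgeComps S, edgeComps S), |M.expansionTerm S S x.1 x.2| :=
        Finset.abs_sum_le_sum_abs _ _
    _ ≤ ∑ x ∈ I.erase (edgeComps S, edgeComps S), 2 * K * M.qbar ^ S.card *
        (y ^ (edgeComps S \ x.1).card * y ^ (edgeComps S \ x.2).card) := by
        refine Finset.sum_le_sum fun x hx => ?_
        have hx := Finset.mem_of_mem_erase hx
        rw [Finset.mem_product, Finset.mem_powerset, Finset.mem_powerset] at hx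
        have := h.expansionTerm_le hS hS (Linked.refl S) hx.1 hx.2
        simpa [hsq] using this
    _ ≤ 2 * K * M.qbar ^ S.card * ((1 + y) ^ (2 * D) - 1) := by
        rw [← Finset.mul_sum]
        have h2 := h.sum_le hS hS
        rw [← Finset.add_sum_erase _ _ htop] at h2
        simp only [sdiff_self, Finset.bot_eq_empty, Finset.card_empty, pow_zero, mul_one] at h2
        gcongr
        linarith
    _ = _ := by ring

end LatentGraphModel

/-- Through `(1 + x) ^ m ≤ exp (m * x)` and `|exp t - 1| ≤ 2 * |t|` for `|t| ≤ 1`. -/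
lemma one_add_pow_le {x : ℝ} (hx : 0 ≤ x) {m : ℕ} (h : m * x ≤ 1) :
    (1 + x) ^ m ≤ 1 + 2 * (m * x) := by
  have h0 : 0 ≤ m * x := by positivity
  have h1 : (1 + x) ^ m ≤ Real.exp (m * x) := by
    rw [Real.exp_nat_mul]
    gcongr
    linarith [Real.add_one_le_exp x]
  have h2 := Real.abs_exp_sub_one_le (x := m * x) (by rwa [abs_of_nonneg h0])
  rw [abs_of_nonneg h0] at h2
  linarith [le_abs_self (Real.exp (m * x) - 1)]

/-- Schur's test for a symmetric matrix, with weights `w`. -/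
lemma abs_sum_sum_mul_le_of_row_sum_le {ι : Type*} (s : Finset ι) (A : ι → ι → ℝ)
    (hA : ∀ i j, A i j = A j i) (w : ι → ℝ) (hw : ∀ i, 0 < w i) {R : ℝ}
    (hR : ∀ i ∈ s, ∑ j ∈ s, |A i j| * (w i / w j) ≤ R) (β : ι → ℝ) :
    |∑ i ∈ s, ∑ j ∈ s, β i * β j * A i j| ≤ R * ∑ i ∈ s, β i ^ 2 := by
  have hrow : ∑ i ∈ s, ∑ j ∈ s, β i ^ 2 * (|A i j| * (w i / w j)) ≤ R * ∑ i ∈ s, β i ^ 2 := by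
    rw [Finset.mul_sum]
    refine Finset.sum_le_sum fun i hi => ?_
    rw [← Finset.mul_sum, mul_comm R]
    exact mul_le_mul_of_nonneg_left (hR i hi) (sq_nonneg _)
  -- By symmetry the two halves of the weighted AM-GM inequality below have the same sum, so row
  -- sums alone suffice.
  have hcol : ∑ i ∈ s, ∑ j ∈ s, β j ^ 2 * (|A i j| * (w j / w i)) =
      ∑ i ∈ s, ∑ j ∈ s, β i ^ 2 * (|A i j| * (w i / w j)) := by
    rw [Finset.sum_comm]
    refine Finset.sum_congr rfl fun i _ => Finset.sum_congr rfl fun j _ => ?_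
    rw [hA j i]
  have hpt : ∀ i j, |β i * β j * A i j| ≤
      (β i ^ 2 * (|A i j| * (w i / w j)) + β j ^ 2 * (|A i j| * (w j / w i))) / 2 := by
    intro i j
    have hi := hw i
    have hj := hw j
    rw [abs_mul, abs_mul, ← sq_abs (β i), ← sq_abs (β j)]
    have h1 : 2 * (|β i| * |β j|) ≤ |β i| ^ 2 * (w i / w j) + |β j| ^ 2 * (w j / w i) := by
      have h2 := two_mul_le_add_sq (|β i| * w i) (|β j| * w j)
      have h3 : |β i| ^ 2 * (w i / w j) + |β j| ^ 2 * (w j / w i) =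
          ((|β i| * w i) ^ 2 + (|β j| * w j) ^ 2) / (w i * w j) := by
        field_simp
      rw [h3, le_div_iff₀ (by positivity)]
      linarith
    nlinarith [mul_le_mul_of_nonneg_left h1 (abs_nonneg (A i j))]
  calc _ ≤ ∑ i ∈ s, ∑ j ∈ s, |β i * β j * A i j| :=
        (Finset.abs_sum_le_sum_abs _ _).trans
          (Finset.sum_le_sum fun i _ => Finset.abs_sum_le_sum_abs _ _)
    _ ≤ ∑ i ∈ s, ∑ j ∈ s,
        (β i ^ 2 * (|A i j| * (w i / w j)) + β j ^ 2 * (|A i j| * (w j / w i))) / 2 :=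
        Finset.sum_le_sum fun i _ => Finset.sum_le_sum fun j _ => hpt i j
    _ = ∑ i ∈ s, ∑ j ∈ s, β i ^ 2 * (|A i j| * (w i / w j)) := by
        simp only [← Finset.sum_div, Finset.sum_add_distrib]
        rw [hcol]
        ring
    _ ≤ _ := hrow

/-! ### Weighted count of the edge sets near a given one. -/

section Counting

variable {n : ℕ}

/-- The weighted number of sets of at most `m` nodes is at most `m + 1`. -/
lemma sum_inv_pow_card_le (n m : ℕ) :
    ∑ X : Finset (Fin n) with X.card ≤ m, ((n : ℝ)⁻¹) ^ X.card ≤ m + 1 := by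
  classical
  have hmap : ∀ X ∈ (Finset.univ.filter fun X : Finset (Fin n) => X.card ≤ m),
      X.card ∈ Finset.range (m + 1) := by
    intro X hX
    rw [Finset.mem_filter] at hX
    exact Finset.mem_range.2 (by omega)
  rw [← Finset.sum_fiberwise_of_maps_to hmap]
  -- There are at most `n.choose j ≤ n ^ j` sets of size `j`: each size contributes at most `1`.
  have : ∀ j ∈ Finset.range (m + 1), ∑ X ∈ (Finset.univ.filter fun X : Finset (Fin n) =>
      X.card ≤ m) with X.card = j, ((n : ℝ)⁻¹) ^ X.card ≤ 1 := by
    intro j hj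
    have hsub : ((Finset.univ.filter fun X : Finset (Fin n) => X.card ≤ m).filter
        fun X => X.card = j) ⊆ Finset.powersetCard j Finset.univ := by
      intro X hX
      rw [Finset.mem_filter] at hX
      exact Finset.mem_powersetCard.2 ⟨Finset.subset_univ _, hX.2⟩
    have hc := Finset.card_le_card hsub
    rw [Finset.card_powersetCard, Finset.card_univ, Fintype.card_fin] at hc
    rw [Finset.sum_congr rfl (g := fun _ => ((n : ℝ)⁻¹) ^ j)
      fun X hX => by rw [(Finset.mem_filter.1 hX).2], Finset.sum_const, nsmul_eq_mul, inv_pow]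
    refine mul_inv_le_one_of_le₀ ?_ (by positivity)
    exact_mod_cast hc.trans (Nat.choose_le_pow n j)
  refine (Finset.sum_le_sum this).trans ?_
  simp

/-- The weighted number of nonempty sets of at most `m` edges, where an edge costs `y` and an
endpoint outside `V₀` costs `1 / n`. -/
lemma sum_pow_card_mul_inv_pow_le {y : ℝ} (hy : 0 ≤ y) {m N : ℕ} (V₀ : Finset (Fin n))
    (hN : V₀.card + 2 * m ≤ N) :
    (open Classical in ∑ T : Finset (NodePair n) with T ≠ ∅ ∧ T.card ≤ m,
      y ^ T.card * ((n : ℝ)⁻¹) ^ (edgeSupp T \ V₀).card) ≤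
      (2 * m + 1) * ((1 + y) ^ N ^ 2 - 1) := by
  classical
  set 𝒯 := Finset.univ.filter fun T : Finset (NodePair n) => T ≠ ∅ ∧ T.card ≤ m
  -- The new endpoints `X` are chosen first, at most `2 * m` of them; the edges are then chosen
  -- inside `V₀ ∪ X`, among at most `N ^ 2` pairs.
  have hmap : ∀ T ∈ 𝒯, edgeSupp T \ V₀ ∈
      (Finset.univ.filter fun X : Finset (Fin n) => X.card ≤ 2 * m) := by
    intro T hT
    refine Finset.mem_filter.2 ⟨Finset.mem_univ _, ?_⟩
    have h1 := (Finset.mem_filter.1 hT).2.2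
    have h2 := card_edgeSupp_le T
    have h3 := Finset.card_le_card (Finset.sdiff_subset (s := edgeSupp T) (t := V₀))
    omega
  rw [← Finset.sum_fiberwise_of_maps_to hmap]
  have hfib : ∀ X ∈ (Finset.univ.filter fun X : Finset (Fin n) => X.card ≤ 2 * m),
      ∑ T ∈ 𝒯 with edgeSupp T \ V₀ = X, y ^ T.card * ((n : ℝ)⁻¹) ^ (edgeSupp T \ V₀).card ≤
        ((1 + y) ^ N ^ 2 - 1) * ((n : ℝ)⁻¹) ^ X.card := by
    intro X hX
    have hXc := (Finset.mem_filter.1 hX).2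
    rw [Finset.sum_congr rfl (g := fun T => y ^ T.card * ((n : ℝ)⁻¹) ^ X.card)
      fun T hT => by rw [(Finset.mem_filter.1 hT).2], ← Finset.sum_mul]
    gcongr
    set E := Finset.univ.filter fun e : NodePair n => ∀ v ∈ e.1, v ∈ V₀ ∪ X
    have hE : E.card ≤ N ^ 2 := by
      have h1 : E.card ≤ (V₀ ∪ X).sym2.card := by
        refine Finset.card_le_card_of_injOn Subtype.val ?_ Subtype.val_injective.injOn
        intro e he
        exact Finset.mem_sym2_iff.2 (Finset.mem_filter.1 he).2
      have h2 : (V₀ ∪ X).card ≤ N := (Finset.card_union_le _ _).trans (by omega)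
      rw [Finset.card_sym2, Nat.choose_two_right] at h1
      have h3 : ((V₀ ∪ X).card + 1) * ((V₀ ∪ X).card + 1 - 1) / 2 ≤ (V₀ ∪ X).card ^ 2 := by
        refine Nat.div_le_of_le_mul ?_
        rcases (V₀ ∪ X).card with _ | c
        · simp
        · simp only [Nat.add_sub_cancel]; nlinarith
      exact h1.trans (h3.trans (Nat.pow_le_pow_left h2 2))
    have hsub : (𝒯.filter fun T => edgeSupp T \ V₀ = X) ⊆ E.powerset.erase ∅ := by
      intro T hT
      obtain ⟨hT, hTX⟩ := Finset.mem_filter.1 hT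
      refine Finset.mem_erase.2 ⟨(Finset.mem_filter.1 hT).2.1, Finset.mem_powerset.2 ?_⟩
      intro e he
      refine Finset.mem_filter.2 ⟨Finset.mem_univ _, fun v hv => ?_⟩
      by_cases hv₀ : v ∈ V₀
      · exact Finset.mem_union_left _ hv₀
      · refine Finset.mem_union_right _ ?_
        rw [← hTX]
        exact Finset.mem_sdiff.2 ⟨mem_edgeSupp.2 ⟨e, he, hv⟩, hv₀⟩
    -- Excluding the empty set gives the `- 1`, which makes the count of order `y`.
    calc _ ≤ ∑ T ∈ E.powerset.erase ∅, y ^ T.card :=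
          Finset.sum_le_sum_of_subset_of_nonneg hsub fun _ _ _ => by positivity
      _ = (1 + y) ^ E.card - 1 := by
          rw [eq_sub_iff_add_eq, add_comm]
          have h1 := Finset.add_sum_erase E.powerset (fun T => y ^ T.card)
            (Finset.empty_mem_powerset E)
          rw [Finset.card_empty, pow_zero] at h1
          rw [h1, ← Finset.prod_const, add_comm, Finset.prod_add]
          simp
      _ ≤ _ := by
          gcongr
          linarith
  refine (Finset.sum_le_sum hfib).trans ?_
  rw [← Finset.mul_sum, mul_comm]
  have h1 : (1 : ℝ) ≤ (1 + y) ^ N ^ 2 := one_le_pow₀ (by linarith)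
  have h2 := sum_inv_pow_card_le n (2 * m)
  push_cast at h2
  exact mul_le_mul_of_nonneg_right h2 (by linarith)

end Counting

/-! ### Row sums of the Gram matrix and Schur's test. -/

namespace LatentGraphModel

variable {n : ℕ} {M : LatentGraphModel n}

/-- The normalized Gram matrix of the centered monomials, minus the identity matrix. -/
def gramDefect (M : LatentGraphModel n) (S T : Finset (NodePair n)) : ℝ :=
  open Classical in
  (∫ A, M.monoBar S A * M.monoBar T A ∂M.law) / √M.qbar ^ (S.card + T.card) -
    if S = T then 1 else 0

lemma gramDefect_comm (S T : Finset (NodePair n)) : M.gramDefect S T = M.gramDefect T S := by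
  simp only [gramDefect, mul_comm (M.monoBar S _), add_comm S.card, eq_comm (a := S)]

/-- The rows of the defect of the Gram matrix are small. -/
lemma MomentBounds.sum_gramDefect_le {D : ℕ} {K a b pb y δ : ℝ}
    (h : M.MomentBounds D K a b pb y)
    (hδ : ∀ S : Finset (NodePair n), S.card ≤ D →
      |∫ A, M.mono S A ^ 2 ∂M.law - M.qbar ^ S.card| ≤ δ * M.qbar ^ S.card)
    {S : Finset (NodePair n)} (hS : S.card ≤ D) :
    ∑ T : Finset (NodePair n) with T.card ≤ D, |M.gramDefect S T| *
        (√n ^ (edgeSupp S).card / √n ^ (edgeSupp T).card) ≤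
      2 * K * ((1 + y) ^ (2 * D) - 1) + δ +
        2 * K * (1 + y) ^ (2 * D) * ((4 * D + 1) * ((1 + y) ^ (6 * D) ^ 2 - 1)) := by
  classical
  have hK := h.one_le_K
  have hy := h.y_nonneg
  have hq := M.qbar_pos
  have hn : (0 : ℝ) < n := by exact_mod_cast Nat.pos_of_ne_zero h.n_ne_zero
  have hsn : (0 : ℝ) < √n := Real.sqrt_pos.2 hn
  have hsq : 0 < √M.qbar := Real.sqrt_pos.2 hq
  have hSmem : S ∈ (Finset.univ.filter fun T : Finset (NodePair n) => T.card ≤ D) := by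
    simpa using hS
  rw [← Finset.add_sum_erase _ _ hSmem]
  refine add_le_add ?_ ?_
  · have h1 := h.abs_integral_monoBar_sq_sub_le hS
    have h2 := hδ S hS
    have hqS : 0 < M.qbar ^ S.card := by positivity
    have hsq' : √M.qbar ^ (S.card + S.card) = M.qbar ^ S.card := by
      rw [← two_mul, pow_mul, Real.sq_sqrt hq.le]
    rw [div_self (by positivity), mul_one, gramDefect, if_pos rfl, hsq', div_sub_one hqS.ne',
      abs_div, abs_of_pos hqS, div_le_iff₀ hqS]
    have h3 := abs_sub_le (∫ A, M.monoBar S A * M.monoBar S A ∂M.law)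
      (∫ A, M.mono S A ^ 2 ∂M.law) (M.qbar ^ S.card)
    linarith
  · have hterm : ∀ T ∈ (Finset.univ.filter fun T : Finset (NodePair n) => T.card ≤ D).erase S,
        |M.gramDefect S T| * (√n ^ (edgeSupp S).card / √n ^ (edgeSupp T).card) ≤
          2 * K * (1 + y) ^ (2 * D) * (y ^ (symmDiff S T).card *
            ((n : ℝ)⁻¹) ^ (edgeSupp (symmDiff S T) \ edgeSupp S).card) := by
      intro T hT
      obtain ⟨hTS, hT⟩ := Finset.mem_erase.1 hT
      have hT := (Finset.mem_filter.1 hT).2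
      have h1 := h.abs_integral_monoBar_mul_le hS hT
      have hcard : (edgeSupp T).card + (symmDiff (edgeSupp S) (edgeSupp T)).card =
          (edgeSupp S).card + 2 * (edgeSupp T \ edgeSupp S).card := by
        have h2 := card_symmDiff_add (edgeSupp S) (edgeSupp T)
        have h3 := Finset.card_sdiff_add_card_inter (edgeSupp T) (edgeSupp S)
        rw [Finset.inter_comm] at h3
        omega
      -- The ratio of Schur weights cancels against the decay in `|V(S) ∆ V(T)|`, leaving `1 / n`
      -- per node of `T` outside `S`.
      have hratio : √n ^ (edgeSupp S).card / √n ^ (edgeSupp T).card =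
          √n ^ (symmDiff (edgeSupp S) (edgeSupp T)).card *
            ((n : ℝ)⁻¹) ^ (edgeSupp T \ edgeSupp S).card := by
        have h4 : (n : ℝ) ^ (edgeSupp T \ edgeSupp S).card =
            √n ^ (2 * (edgeSupp T \ edgeSupp S).card) := by
          rw [pow_mul, Real.sq_sqrt hn.le]
        rw [inv_pow, h4, ← div_eq_mul_inv, div_eq_div_iff (by positivity) (by positivity),
          ← pow_add, ← pow_add, ← hcard, add_comm]
      have hsub : edgeSupp (symmDiff S T) \ edgeSupp S ⊆ edgeSupp T \ edgeSupp S := by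
        intro v hv
        obtain ⟨hv, hvS⟩ := Finset.mem_sdiff.1 hv
        obtain ⟨e, he, hve⟩ := mem_edgeSupp.1 hv
        rw [Finset.mem_symmDiff] at he
        refine Finset.mem_sdiff.2 ⟨?_, hvS⟩
        rcases he with he | he
        · exact absurd (mem_edgeSupp.2 ⟨e, he.1, hve⟩) hvS
        · exact mem_edgeSupp.2 ⟨e, he.1, hve⟩
      have hinv : ((n : ℝ)⁻¹) ^ (edgeSupp T \ edgeSupp S).card ≤
          ((n : ℝ)⁻¹) ^ (edgeSupp (symmDiff S T) \ edgeSupp S).card := by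
        refine pow_le_pow_of_le_one (by positivity) ?_ (Finset.card_le_card hsub)
        exact inv_le_one_of_one_le₀ (by exact_mod_cast Nat.pos_of_ne_zero h.n_ne_zero)
      rw [gramDefect, if_neg (Ne.symm hTS), sub_zero, abs_div,
        abs_of_pos (a := √M.qbar ^ (S.card + T.card)) (by positivity), hratio, ← mul_assoc,
        ← mul_assoc]
      refine mul_le_mul ?_ hinv (by positivity) (by positivity)
      rw [div_mul_eq_mul_div, div_le_iff₀ (by positivity)]
      exact h1
    refine (Finset.sum_le_sum hterm).trans ?_
    rw [← Finset.mul_sum]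
    refine mul_le_mul_of_nonneg_left ?_ (by positivity)
    have hcount := sum_pow_card_mul_inv_pow_le hy (m := 2 * D) (N := 6 * D) (edgeSupp S)
      (by have := card_edgeSupp_le S; omega)
    push_cast at hcount
    rw [show (2 : ℝ) * (2 * D) = 4 * D by ring] at hcount
    refine le_trans ?_ hcount
    -- The row is indexed by `S ∆ T`, an injective function of `T`: a nonempty set of at most `2 *
    -- D` edges, with `S` contributing at most `2 * D` old nodes. This explains `N = 6 * D`.
    rw [← Finset.sum_image (s := (Finset.univ.filter
        fun T : Finset (NodePair n) => T.card ≤ D).erase S) (g := fun T => symmDiff S T)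
      (f := fun T => y ^ T.card * ((n : ℝ)⁻¹) ^ (edgeSupp T \ edgeSupp S).card)
      (symmDiff_right_injective S).injOn]
    refine Finset.sum_le_sum_of_subset_of_nonneg ?_ fun _ _ _ => by positivity
    intro T' hT'
    obtain ⟨T, hT, rfl⟩ := Finset.mem_image.1 hT'
    obtain ⟨hTS, hT⟩ := Finset.mem_erase.1 hT
    have hT := (Finset.mem_filter.1 hT).2
    refine Finset.mem_filter.2 ⟨Finset.mem_univ _, fun h0 => hTS ?_, ?_⟩
    · exact (symmDiff_eq_bot.1 h0).symm
    · have := card_symmDiff_add S T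
      omega

/-- The second moment of a linear combination of normalized centered monomials is close to the
squared norm of the coefficients. -/
lemma MomentBounds.abs_integral_sum_sq_sub_le {D : ℕ} {K a b pb y δ : ℝ}
    (h : M.MomentBounds D K a b pb y)
    (hδ : ∀ S : Finset (NodePair n), S.card ≤ D →
      |∫ A, M.mono S A ^ 2 ∂M.law - M.qbar ^ S.card| ≤ δ * M.qbar ^ S.card)
    (β : Finset (NodePair n) → ℝ) :
    |∫ A, (∑ S : Finset (NodePair n) with S.card ≤ D,
        β S * (M.monoBar S A / √M.qbar ^ S.card)) ^ 2 ∂M.law -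
        ∑ S : Finset (NodePair n) with S.card ≤ D, β S ^ 2| ≤
      (2 * K * ((1 + y) ^ (2 * D) - 1) + δ +
        2 * K * (1 + y) ^ (2 * D) * ((4 * D + 1) * ((1 + y) ^ (6 * D) ^ 2 - 1))) *
      ∑ S : Finset (NodePair n) with S.card ≤ D, β S ^ 2 := by
  classical
  have := M.law_isProbabilityMeasure h.n_ne_zero
  have hn : (0 : ℝ) < n := by exact_mod_cast Nat.pos_of_ne_zero h.n_ne_zero
  have hsn : (0 : ℝ) < √n := Real.sqrt_pos.2 hn
  set s := Finset.univ.filter fun T : Finset (NodePair n) => T.card ≤ D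
  have hint : ∫ A, (∑ S ∈ s, β S * (M.monoBar S A / √M.qbar ^ S.card)) ^ 2 ∂M.law =
      ∑ S ∈ s, ∑ T ∈ s, β S * β T *
        ((∫ A, M.monoBar S A * M.monoBar T A ∂M.law) / √M.qbar ^ (S.card + T.card)) := by
    simp only [pow_two, Finset.sum_mul_sum]
    rw [integral_finsetSum _ fun _ _ => Integrable.of_finite]
    refine Finset.sum_congr rfl fun S _ => ?_
    rw [integral_finsetSum _ fun _ _ => Integrable.of_finite]
    refine Finset.sum_congr rfl fun T _ => ?_
    rw [← integral_div, ← integral_const_mul]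
    congr 1
    ext A
    rw [pow_add]
    ring
  have hdiag : ∑ S ∈ s, β S ^ 2 = ∑ S ∈ s, ∑ T ∈ s, β S * β T * if S = T then 1 else 0 := by
    refine Finset.sum_congr rfl fun S hS => ?_
    simp [hS, pow_two]
  rw [hint]
  conv_lhs => rw [hdiag]
  simp only [← Finset.sum_sub_distrib, ← mul_sub]
  refine abs_sum_sum_mul_le_of_row_sum_le s (fun S T => M.gramDefect S T) gramDefect_comm
    (fun S => √n ^ (edgeSupp S).card) (fun S => by positivity) (fun S hS => ?_) β
  exact h.sum_gramDefect_le hδ (Finset.mem_filter.1 hS).2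

end LatentGraphModel

/-! ### Labelings of a template, components and automorphisms. -/

section Labelings

variable {n r : ℕ}

/-- The edge set of the labeled graph `G[π]`. -/
def labeledEdges (G : SimpleGraph (Fin r)) (π : Fin r ↪ Fin n) : Finset (NodePair n) :=
  open Classical in Finset.univ.filter fun e => e.1 ∈ (G.map π).edgeSet

lemma graphOf_labeledEdges (G : SimpleGraph (Fin r)) (π : Fin r ↪ Fin n) :
    graphOf (labeledEdges G π) = G.map π := by
  rw [← SimpleGraph.edgeSet_inj, edgeSet_graphOf]
  ext e
  simp only [labeledEdges, Set.mem_image, Finset.mem_coe, Finset.mem_filter, Finset.mem_univ,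
    true_and]
  constructor
  · rintro ⟨e, he, rfl⟩
    exact he
  · exact fun he => ⟨⟨e, (G.map π).not_isDiag_of_mem_edgeSet he⟩, he, rfl⟩

lemma card_labeledEdges (G : SimpleGraph (Fin r)) (π : Fin r ↪ Fin n) :
    (labeledEdges G π).card = G.edgeSet.ncard := by
  rw [← ncard_edgeSet_graphOf, graphOf_labeledEdges, SimpleGraph.edgeSet_map,
    Set.ncard_image_of_injective _ (Function.Embedding.injective _)]

lemma graphOf_injective : Function.Injective (graphOf (n := n)) := by
  intro S T h
  have := congrArg SimpleGraph.edgeSet h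
  rw [edgeSet_graphOf, edgeSet_graphOf] at this
  exact Finset.coe_injective (Subtype.val_injective.image_injective this)

lemma labeledEdges_eq_iff {r' : ℕ} {G : SimpleGraph (Fin r)} {π : Fin r ↪ Fin n}
    {G' : SimpleGraph (Fin r')} {π' : Fin r' ↪ Fin n} :
    labeledEdges G π = labeledEdges G' π' ↔ G.map π = G'.map π' := by
  rw [← graphOf_labeledEdges, ← graphOf_labeledEdges, graphOf_injective.eq_iff]

lemma mem_labeledEdges {G : SimpleGraph (Fin r)} {π : Fin r ↪ Fin n} {e : NodePair n} :
    e ∈ labeledEdges G π ↔ ∃ u v, G.Adj u v ∧ e.1 = s(π u, π v) := by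
  simp only [labeledEdges, Finset.mem_filter, Finset.mem_univ, true_and]
  obtain ⟨e, he⟩ := e
  induction e with
  | _ a b =>
    simp only [SimpleGraph.mem_edgeSet, SimpleGraph.map_adj]
    constructor
    · rintro ⟨u, v, h, rfl, rfl⟩
      exact ⟨u, v, h, rfl⟩
    · rintro ⟨u, v, h, he⟩
      rcases Sym2.eq_iff.1 he with ⟨rfl, rfl⟩ | ⟨rfl, rfl⟩
      · exact ⟨u, v, h, rfl, rfl⟩
      · exact ⟨v, u, h.symm, rfl, rfl⟩

lemma reachable_map_iff {G : SimpleGraph (Fin r)} {π : Fin r ↪ Fin n} {u v : Fin r} :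
    (G.map π).Reachable (π u) (π v) ↔ G.Reachable u v := by
  constructor
  · rintro ⟨p⟩
    generalize ha : π u = a at p
    generalize hb : π v = b at p
    induction p generalizing u with
    | nil => rw [π.injective (ha.trans hb.symm)]
    | cons h p ih =>
      rw [SimpleGraph.map_adj] at h
      obtain ⟨x, y, hxy, hx, hy⟩ := h
      obtain rfl := π.injective (ha.trans hx.symm)
      exact hxy.reachable.trans (ih hy hb)
  · rintro ⟨p⟩
    induction p with
    | nil => exact SimpleGraph.Reachable.refl _
    | cons h p ih =>
      refine SimpleGraph.Reachable.trans (SimpleGraph.Adj.reachable ?_) ih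
      exact (SimpleGraph.map_adj ..).2 ⟨_, _, h, rfl, rfl⟩

/-- The edge set of a connected component of a labeled graph. -/
def labeledComp (G : SimpleGraph (Fin r)) (π : Fin r ↪ Fin n) (C : G.ConnectedComponent) :
    Finset (NodePair n) :=
  labeledEdges (G.induce C.supp).spanningCoe π

lemma mem_labeledComp {G : SimpleGraph (Fin r)} {π : Fin r ↪ Fin n} {C : G.ConnectedComponent}
    {e : NodePair n} : e ∈ labeledComp G π C ↔
      ∃ u v, G.Adj u v ∧ G.connectedComponentMk u = C ∧ e.1 = s(π u, π v) := by
  rw [labeledComp, mem_labeledEdges]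
  constructor
  · rintro ⟨u, v, h, he⟩
    rw [SimpleGraph.map_adj] at h
    obtain ⟨a, b, h, rfl, rfl⟩ := h
    exact ⟨a, b, h, a.2, he⟩
  · rintro ⟨u, v, h, hu, he⟩
    have hv : G.connectedComponentMk v = C := by
      rw [← hu]; exact SimpleGraph.ConnectedComponent.sound h.symm.reachable
    exact ⟨u, v, (SimpleGraph.map_adj ..).2 ⟨⟨u, hu⟩, ⟨v, hv⟩, h, rfl, rfl⟩, he⟩

lemma mem_labeledComp_iff_reachable {G : SimpleGraph (Fin r)} {π : Fin r ↪ Fin n} {u w : Fin r}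
    (h : G.Adj u w) {e : NodePair n} (he : e.1 = s(π u, π w)) (e' : NodePair n) :
    e' ∈ labeledComp G π (G.connectedComponentMk u) ↔ e' ∈ labeledEdges G π ∧
      ∃ a ∈ e.1, ∃ b ∈ e'.1, (graphOf (labeledEdges G π)).Reachable a b := by
  rw [mem_labeledComp, mem_labeledEdges, graphOf_labeledEdges, he]
  constructor
  · rintro ⟨x, y, hxy, hx, he'⟩
    refine ⟨⟨x, y, hxy, he'⟩, π u, by simp, π x, by simp [he'], ?_⟩
    exact reachable_map_iff.2 (SimpleGraph.ConnectedComponent.exact hx.symm)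
  · rintro ⟨⟨x, y, hxy, he'⟩, a, ha, b, hb, hab⟩
    refine ⟨x, y, hxy, SimpleGraph.ConnectedComponent.sound ?_, he'⟩
    have h1 : ∃ c, a = π c ∧ G.Reachable c u := by
      rcases Sym2.mem_iff.1 ha with rfl | rfl
      · exact ⟨u, rfl, SimpleGraph.Reachable.refl _⟩
      · exact ⟨w, rfl, h.symm.reachable⟩
    have h2 : ∃ c, b = π c ∧ G.Reachable c x := by
      rw [he'] at hb
      rcases Sym2.mem_iff.1 hb with rfl | rfl
      · exact ⟨x, rfl, SimpleGraph.Reachable.refl _⟩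
      · exact ⟨y, rfl, hxy.symm.reachable⟩
    obtain ⟨c, rfl, hc⟩ := h1
    obtain ⟨d, rfl, hd⟩ := h2
    exact (hd.symm.trans (reachable_map_iff.1 hab).symm).trans hc

open Classical in
-- Without isolated nodes every component of `G` carries an edge, so none yields the empty set,
-- which is never a member of `edgeComps`.
lemma edgeComps_labeledEdges {G : SimpleGraph (Fin r)} (hG : ∀ v, ∃ w, G.Adj v w)
    (π : Fin r ↪ Fin n) :
    edgeComps (labeledEdges G π) = Finset.univ.image (labeledComp G π) := by
  ext K
  rw [Finset.mem_image, mem_edgeComps]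
  constructor
  · rintro ⟨e, he, hK⟩
    obtain ⟨u, w, h, he⟩ := mem_labeledEdges.1 he
    refine ⟨G.connectedComponentMk u, Finset.mem_univ _, ?_⟩
    ext e'
    rw [hK, mem_labeledComp_iff_reachable h he]
  · rintro ⟨C, -, rfl⟩
    induction C using SimpleGraph.ConnectedComponent.ind with
    | _ u =>
      obtain ⟨w, h⟩ := hG u
      have hd : ¬ (s(π u, π w)).IsDiag := by
        rw [Sym2.mk_isDiag_iff, π.injective.eq_iff]
        exact h.ne
      exact ⟨⟨s(π u, π w), hd⟩, mem_labeledEdges.2 ⟨u, w, h, rfl⟩,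
        mem_labeledComp_iff_reachable h rfl⟩

lemma labeledComp_injective {G : SimpleGraph (Fin r)} (hG : ∀ v, ∃ w, G.Adj v w)
    (π : Fin r ↪ Fin n) : Function.Injective (labeledComp G π) := by
  intro C C' hCC
  induction C using SimpleGraph.ConnectedComponent.ind with
  | _ u =>
    obtain ⟨w, h⟩ := hG u
    have hd : ¬ (s(π u, π w)).IsDiag := by
      rw [Sym2.mk_isDiag_iff, π.injective.eq_iff]
      exact h.ne
    have hmem : (⟨s(π u, π w), hd⟩ : NodePair n) ∈ labeledComp G π C' := by
      rw [← hCC]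
      exact mem_labeledComp.2 ⟨u, w, h, rfl, rfl⟩
    obtain ⟨x, y, hxy, hx, he⟩ := mem_labeledComp.1 hmem
    rw [← hx]
    rcases Sym2.eq_iff.1 he with ⟨h1, -⟩ | ⟨h1, -⟩
    · rw [π.injective h1]
    · rw [π.injective h1]
      exact SimpleGraph.ConnectedComponent.sound hxy.symm.reachable

/-- Two labelings with the same edges differ by an isomorphism. -/
lemma exists_iso_of_map_eq {r' : ℕ} {G : SimpleGraph (Fin r)} {G' : SimpleGraph (Fin r')}
    (hG : ∀ v, ∃ w, G.Adj v w) (hG' : ∀ v, ∃ w, G'.Adj v w) {π : Fin r ↪ Fin n}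
    {π' : Fin r' ↪ Fin n} (h : G.map π = G'.map π') :
    ∃ σ : G ≃g G', ∀ v, π' (σ v) = π v := by
  -- As no node is isolated, each `π v` is an endpoint of the common graph, hence in the range of
  -- the other labeling.
  have key : ∀ {r r' : ℕ} {G : SimpleGraph (Fin r)} {G' : SimpleGraph (Fin r')}
      {π : Fin r ↪ Fin n} {π' : Fin r' ↪ Fin n}, (∀ v, ∃ w, G.Adj v w) → G.map π = G'.map π' →
      ∀ v, ∃ u, π' u = π v := by
    intro r r' G G' π π' hG h v
    obtain ⟨w, hw⟩ := hG v
    have : (G.map π).Adj (π v) (π w) := (SimpleGraph.map_adj ..).2 ⟨v, w, hw, rfl, rfl⟩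
    rw [h, SimpleGraph.map_adj] at this
    obtain ⟨u, -, -, hu, -⟩ := this
    exact ⟨u, hu⟩
  choose f hf using key hG h
  choose g hg using key hG' h.symm
  refine ⟨⟨⟨f, g, fun v => π.injective (by rw [hg, hf]), fun v => π'.injective (by rw [hf, hg])⟩,
    ?_⟩, hf⟩
  intro a b
  have h1 : (G.map π).Adj (π a) (π b) ↔ G.Adj a b := SimpleGraph.map_adj_apply
  have h2 : (G'.map π').Adj (π' (f a)) (π' (f b)) ↔ G'.Adj (f a) (f b) :=
    SimpleGraph.map_adj_apply
  rw [hf, hf, ← h, h1] at h2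
  exact h2.symm

/-- A labeled graph arises from as many labelings as the graph has automorphisms. -/
lemma card_labelings_eq {G : SimpleGraph (Fin r)} (hG : ∀ v, ∃ w, G.Adj v w)
    (π : Fin r ↪ Fin n) :
    (open Classical in (Finset.univ.filter fun π' : Fin r ↪ Fin n =>
      labeledEdges G π' = labeledEdges G π).card) = Nat.card (G ≃g G) := by
  classical
  rw [← Fintype.card_subtype, ← Nat.card_eq_fintype_card]
  symm
  refine Nat.card_eq_of_bijective (fun σ : G ≃g G =>
    (⟨σ.toEquiv.toEmbedding.trans π, ?_⟩ : {π' : Fin r ↪ Fin n //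
      labeledEdges G π' = labeledEdges G π})) ⟨?_, ?_⟩
  · ext e
    rw [mem_labeledEdges, mem_labeledEdges]
    constructor
    · rintro ⟨u, v, h, he⟩
      exact ⟨σ u, σ v, σ.map_adj_iff.2 h, he⟩
    · rintro ⟨u, v, h, he⟩
      refine ⟨σ.symm u, σ.symm v, σ.symm.map_adj_iff.2 h, ?_⟩
      simpa using he
  · intro σ τ h
    ext v : 1
    have := DFunLike.congr_fun (congrArg Subtype.val h) v
    exact π.injective this
  · rintro ⟨π', h⟩
    obtain ⟨σ, hσ⟩ := exists_iso_of_map_eq hG hG (labeledEdges_eq_iff.1 h)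
    exact ⟨σ, Subtype.ext (DFunLike.ext _ _ hσ)⟩

end Labelings

/-! ### From templates to edge sets: coefficients and their norm. -/

namespace LatentGraphModel

variable {n : ℕ} (M : LatentGraphModel n)

lemma monoPbar_eq_monoBar {r : ℕ} {G : SimpleGraph (Fin r)} (hG : ∀ v, ∃ w, G.Adj v w)
    (π : Fin r ↪ Fin n) (A : NodePair n → Bool) :
    M.monoPbar G π A = M.monoBar (labeledEdges G π) A := by
  classical
  rw [monoBar, edgeComps_labeledEdges hG, Finset.prod_image (labeledComp_injective hG π).injOn,
    monoPbar]
  have : ∀ (C : G.ConnectedComponent) B,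
      M.monoP (G.induce C.supp).spanningCoe π B = M.mono (labeledComp G π C) B :=
    fun C B => M.monoP_eq_mono (graphOf_labeledEdges _ _).symm B
  simp only [this]

lemma monoBar_empty (A : NodePair n → Bool) : M.monoBar ∅ A = 1 := by
  simp [monoBar, edgeComps]

lemma varProxy_pos {G : FinGraph} (hG : G.1 ≤ n) : 0 < M.varProxy G := by
  have h1 : 0 < n.descFactorial G.1 := Nat.pos_of_ne_zero fun h => by
    rw [Nat.descFactorial_eq_zero_iff_lt] at h; omega
  have : Finite (G.2 ≃g G.2) := Finite.of_injective (fun σ => (σ : Fin G.1 → Fin G.1))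
    DFunLike.coe_injective
  have : Nonempty (G.2 ≃g G.2) := ⟨SimpleGraph.Iso.refl⟩
  have h2 : 0 < Nat.card (G.2 ≃g G.2) := Nat.card_pos
  have := M.qbar_pos
  unfold varProxy
  positivity

/-- The coefficients of a linear combination of the polynomials `Ψ_G` on the normalized centered
monomials. -/
def labeledCoeff (𝒢 : Finset FinGraph) (α : FinGraph → ℝ) (S : Finset (NodePair n)) : ℝ :=
  open Classical in
  ∑ G ∈ 𝒢, ∑ π : Fin G.1 ↪ Fin n, if labeledEdges G.2 π = S then
    α G * √M.qbar ^ G.2.edgeSet.ncard / √(M.varProxy G) else 0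

open Classical in
-- Used twice: with `f` the normalized centered monomials to rewrite the polynomial, and with `f`
-- the coefficients themselves to compute their norm.
lemma sum_labeledCoeff_mul {D : ℕ} {𝒢 : Finset FinGraph} (h𝒢 : IsTemplateCollection D 𝒢)
    (α : FinGraph → ℝ) (f : Finset (NodePair n) → ℝ) :
    ∑ S : Finset (NodePair n) with S.card ≤ D, M.labeledCoeff 𝒢 α S * f S =
      ∑ G ∈ 𝒢, ∑ π : Fin G.1 ↪ Fin n, α G * √M.qbar ^ G.2.edgeSet.ncard / √(M.varProxy G) *
        f (labeledEdges G.2 π) := by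
  simp only [labeledCoeff, Finset.sum_mul]
  rw [Finset.sum_comm]
  refine Finset.sum_congr rfl fun G hG => ?_
  rw [Finset.sum_comm]
  refine Finset.sum_congr rfl fun π _ => ?_
  have hmem : labeledEdges G.2 π ∈
      (Finset.univ.filter fun S : Finset (NodePair n) => S.card ≤ D) := by
    simpa [card_labeledEdges] using (h𝒢.1 G hG).2.2
  simp only [ite_mul, zero_mul]
  rw [Finset.sum_ite_eq, if_pos hmem]

lemma labeledCoeff_empty {D : ℕ} {𝒢 : Finset FinGraph} (h𝒢 : IsTemplateCollection D 𝒢)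
    (α : FinGraph → ℝ) : M.labeledCoeff 𝒢 α ∅ = 0 := by
  refine Finset.sum_eq_zero fun G hG => Finset.sum_eq_zero fun π _ => if_neg fun h => ?_
  have h1 := (h𝒢.1 G hG).2.1
  rw [← card_labeledEdges G.2 π, h] at h1
  simp at h1

lemma sum_psi_eq {D : ℕ} {𝒢 : Finset FinGraph} (h𝒢 : IsTemplateCollection D 𝒢) (α₀ : ℝ)
    (α : FinGraph → ℝ) (A : NodePair n → Bool) :
    α₀ + ∑ G ∈ 𝒢, α G * M.psi G A = ∑ S : Finset (NodePair n) with S.card ≤ D,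
      ((if S = ∅ then α₀ else 0) + M.labeledCoeff 𝒢 α S) *
        (M.monoBar S A / √M.qbar ^ S.card) := by
  classical
  have hq : √M.qbar ≠ 0 := (Real.sqrt_pos.2 M.qbar_pos).ne'
  simp only [add_mul, Finset.sum_add_distrib]
  rw [M.sum_labeledCoeff_mul h𝒢]
  congr 1
  · simp [ite_mul, monoBar_empty]
  · refine Finset.sum_congr rfl fun G hG => ?_
    rw [psi, polyPbar, Finset.sum_div, Finset.mul_sum]
    refine Finset.sum_congr rfl fun π _ => ?_
    rw [M.monoPbar_eq_monoBar (h𝒢.1 G hG).1, card_labeledEdges]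
    field_simp

/-- Templates with a common labeled copy are isomorphic, so only `G` contributes, once per
automorphism. -/
lemma labeledCoeff_labeledEdges {D : ℕ} {𝒢 : Finset FinGraph} (h𝒢 : IsTemplateCollection D 𝒢)
    (α : FinGraph → ℝ) {G : FinGraph} (hG : G ∈ 𝒢) (π : Fin G.1 ↪ Fin n) :
    M.labeledCoeff 𝒢 α (labeledEdges G.2 π) = Nat.card (G.2 ≃g G.2) *
      (α G * √M.qbar ^ G.2.edgeSet.ncard / √(M.varProxy G)) := by
  classical
  rw [labeledCoeff, Finset.sum_eq_single_of_mem G hG]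
  · rw [← Finset.sum_filter, Finset.sum_const, nsmul_eq_mul, card_labelings_eq (h𝒢.1 G hG).1]
  · intro G' hG' hne
    refine Finset.sum_eq_zero fun π' _ => if_neg fun h => hne ?_
    obtain ⟨σ, -⟩ := exists_iso_of_map_eq (h𝒢.1 G' hG').1 (h𝒢.1 G hG).1
      (labeledEdges_eq_iff.1 h)
    exact h𝒢.2.1 G' hG' G hG ⟨σ⟩

lemma _root_.card_le_two_mul_of_isTemplate {D : ℕ} {G : FinGraph} (hG : IsTemplate D G) :
    G.1 ≤ 2 * D := by
  let π : Fin G.1 ↪ Fin G.1 := Function.Embedding.refl _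
  have h1 := card_edgeSupp_le (labeledEdges G.2 π)
  rw [card_labeledEdges] at h1
  have h2 : edgeSupp (labeledEdges G.2 π) = Finset.univ := by
    refine Finset.eq_univ_iff_forall.2 fun v => ?_
    have := support_graphOf (labeledEdges G.2 π)
    rw [graphOf_labeledEdges] at this
    rw [← Finset.mem_coe, ← this, SimpleGraph.mem_support]
    obtain ⟨w, hw⟩ := hG.1 v
    exact ⟨w, (SimpleGraph.map_adj ..).2 ⟨v, w, hw, rfl, rfl⟩⟩
  rw [h2, Finset.card_univ, Fintype.card_fin] at h1
  have := hG.2.2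
  omega

/-- Each of the `n! / (n - |V|)!` labelings of `G` contributes `α_G ^ 2 * |Aut G| * q̄ ^ |E| /
𝕍(G)`, which sums to `α_G ^ 2`. The condition `2 * D ≤ n` lets every template embed in `[n]`, so
that `𝕍(G) ≠ 0`. -/
lemma sum_coeff_sq_eq {D : ℕ} {𝒢 : Finset FinGraph} (h𝒢 : IsTemplateCollection D 𝒢)
    (hn : 2 * D ≤ n) (α₀ : ℝ) (α : FinGraph → ℝ) :
    ∑ S : Finset (NodePair n) with S.card ≤ D,
      ((if S = ∅ then α₀ else 0) + M.labeledCoeff 𝒢 α S) ^ 2 = α₀ ^ 2 + ∑ G ∈ 𝒢, α G ^ 2 := by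
  classical
  have hsplit : ∀ S : Finset (NodePair n),
      ((if S = ∅ then α₀ else 0) + M.labeledCoeff 𝒢 α S) ^ 2 =
        (if S = ∅ then α₀ ^ 2 else 0) + M.labeledCoeff 𝒢 α S * M.labeledCoeff 𝒢 α S := by
    intro S
    split_ifs with h
    · rw [h, M.labeledCoeff_empty h𝒢]; ring
    · ring
  simp only [hsplit, Finset.sum_add_distrib]
  rw [M.sum_labeledCoeff_mul h𝒢]
  congr 1
  · simp
  · refine Finset.sum_congr rfl fun G hG => ?_
    have hGn : G.1 ≤ n := (card_le_two_mul_of_isTemplate (h𝒢.1 G hG)).trans hn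
    have hV := M.varProxy_pos hGn
    simp only [M.labeledCoeff_labeledEdges h𝒢 α hG]
    rw [Finset.sum_const, Finset.card_univ, Fintype.card_embedding_eq, Fintype.card_fin,
      Fintype.card_fin, nsmul_eq_mul]
    have h1 : √(M.varProxy G) * √(M.varProxy G) = M.varProxy G := Real.mul_self_sqrt hV.le
    have h2 : √M.qbar ^ G.2.edgeSet.ncard * √M.qbar ^ G.2.edgeSet.ncard =
        M.qbar ^ G.2.edgeSet.ncard := by
      rw [← mul_pow, Real.mul_self_sqrt M.qbar_pos.le]
    have h3 : (n.descFactorial G.1 : ℝ) * (Nat.card (G.2 ≃g G.2) : ℝ) *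
        M.qbar ^ G.2.edgeSet.ncard = M.varProxy G := rfl
    calc _ = α G ^ 2 * ((n.descFactorial G.1 : ℝ) * (Nat.card (G.2 ≃g G.2) : ℝ) *
          (√M.qbar ^ G.2.edgeSet.ncard * √M.qbar ^ G.2.edgeSet.ncard)) /
          (√(M.varProxy G) * √(M.varProxy G)) := by ring
      _ = _ := by rw [h2, h3, h1, mul_div_cancel_right₀ _ hV.ne']

end LatentGraphModel

/-! ### Choice of the small parameters. -/

namespace LatentGraphModel

variable {n : ℕ} {M : LatentGraphModel n}

/-- From `lam ≤ q * s` and `1 - 2q ≤ 1 - q` one gets `p̄ ≤ (1 + s) * q̄`; up to `D` powers cost only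
`1 + 2 * D * s`. -/
lemma pbar_pow_le {lam s : ℝ} {D : ℕ} (hlam : 0 ≤ lam) (hls : lam ≤ M.q * s) (hs : 0 ≤ s)
    (hDs : D * s ≤ 1) {i : ℕ} (hi : i ≤ D) :
    M.pbar lam ^ i ≤ (1 + 2 * (D * s)) * M.qbar ^ i := by
  have hq := M.q_pos
  have hq2 := M.q_le_half
  have hqb := M.qbar_pos
  have h1 : M.pbar lam ≤ (1 + s) * M.qbar := by
    rw [pbar_eq, qbar]
    have h2 : lam * (1 - 2 * M.q) ≤ M.q * s * (1 - M.q) := by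
      apply mul_le_mul hls <;> nlinarith
    linarith
  have h0 : 0 ≤ M.pbar lam := by
    rw [pbar_eq]
    nlinarith
  have hiD : (i : ℝ) * s ≤ D * s := by gcongr
  calc M.pbar lam ^ i ≤ ((1 + s) * M.qbar) ^ i := pow_le_pow_left₀ h0 h1 i
    _ = (1 + s) ^ i * M.qbar ^ i := mul_pow _ _ _
    _ ≤ _ := by
        gcongr
        exact (one_add_pow_le hs (hiD.trans hDs)).trans (by linarith)

/-- The three conditions provide the moment bounds. -/
lemma momentBounds_of_conditions {D k : ℕ} {lam cm cv1 cv2 cv3 cv4 s y : ℝ} (hcm : 0 ≤ cm)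
    (hcv1 : 0 ≤ cv1) (hcv2 : 0 ≤ cv2) (hn : n ≠ 0) (hD : 2 ≤ D)
    (hΘ : ∀ a b, M.Θ a b ∈ Set.Icc 0 lam) (hm : M.CMoment D k lam cm)
    (hv : M.CVariance D k lam cv1 cv2 cv3 cv4) (hlq : lam / M.q ≤ s)
    (hlk : lam * k / √(n * M.q) ≤ s) (hy : 0 ≤ y) (hy1 : y ≤ 1) (hDs : 2 * (D * s) ≤ 1)
    (hsy : 2 * (D : ℝ) ^ (2 * (cm + cv1)) * s ≤ y ^ 2) :
    M.MomentBounds D (1 + cv2) ((D : ℝ) ^ (cm + cv1) * lam) ((D : ℝ) ^ (cm + cv1) * (k / n))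
      (M.pbar lam) y := by
  have hn0 : 0 < n := Nat.pos_of_ne_zero hn
  have hnR : (0 : ℝ) < n := by exact_mod_cast hn0
  have hlam : 0 ≤ lam := (hΘ ⟨0, hn0⟩ ⟨0, hn0⟩).1.trans (hΘ ⟨0, hn0⟩ ⟨0, hn0⟩).2
  have hD1 : (1 : ℝ) ≤ D := by exact_mod_cast (by omega : 1 ≤ D)
  have hq := M.q_pos
  have hq2 := M.q_le_half
  have hqb := M.qbar_pos
  have hs : 0 ≤ s := (div_nonneg hlam hq.le).trans hlq
  have hls : lam ≤ M.q * s := by rwa [div_le_iff₀' hq] at hlq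
  have hc : 0 ≤ cm + cv1 := by linarith
  -- The exponent `cm + cv1` serves both moment conditions. `P` enters both `a` and `b`, so the rank
  -- bound involves `P * P`.
  set P := (D : ℝ) ^ (cm + cv1) with hP
  have hP1 : 1 ≤ P := Real.one_le_rpow hD1 hc
  have hPP : (D : ℝ) ^ (2 * (cm + cv1)) = P * P := by
    rw [two_mul, Real.rpow_add (by linarith)]
  rw [hPP] at hsy
  have hsq : √M.qbar ^ 2 = M.qbar := Real.sq_sqrt hqb.le
  have hsq0 : 0 < √M.qbar := Real.sqrt_pos.2 hqb
  have hqle : M.q ≤ √M.qbar := by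
    apply Real.le_sqrt_of_sq_le
    unfold qbar
    nlinarith
  have hsqrtq : √M.q ≤ 2 * √M.qbar := by
    rw [Real.sqrt_le_iff]
    refine ⟨by positivity, ?_⟩
    rw [mul_pow, hsq, qbar]
    nlinarith
  refine ⟨hn, by linarith, by positivity, by positivity, hy, hy1, ?_, ?_, ?_, ?_, ?_, ?_⟩
  · intro S hS
    refine (M.abs_integral_mono_le hn hm hS).trans ?_
    have : (D : ℝ) ^ cm ≤ P := Real.rpow_le_rpow_of_exponent_le hD1 (by linarith)
    gcongr
  · intro S T hS hT
    exact M.abs_integral_mono_mul_mono_le hn hD hcm hcv1 hcv2 hΘ hm hv hS hT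
  · calc P * lam ≤ P * (M.q * s) := by gcongr
      _ = P * s * M.q := by ring
      _ ≤ y ^ 2 * √M.qbar := by
          have : P * s ≤ y ^ 2 := by
            have : P * s ≤ P * P * s := by
              have := le_mul_of_one_le_right (by positivity : 0 ≤ P) hP1
              gcongr
            nlinarith [mul_nonneg (mul_nonneg (zero_le_one.trans hP1) (zero_le_one.trans hP1)) hs]
          gcongr
  · have h1 : lam * k / √n ≤ s * √M.q := by
      rw [Real.sqrt_mul hnR.le, ← div_div, div_le_iff₀ (Real.sqrt_pos.2 hq)] at hlk
      exact hlk
    calc P * lam * (P * (k / n)) * √n = P * P * (lam * k * (√n / n)) := by ring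
      _ = P * P * (lam * k / √n) := by rw [Real.sqrt_div_self]; ring
      _ ≤ P * P * (s * (2 * √M.qbar)) := by
          have := h1.trans (mul_le_mul_of_nonneg_left hsqrtq hs)
          gcongr
      _ = (2 * (P * P) * s) * √M.qbar := by ring
      _ ≤ _ := by gcongr
  · rw [pbar_eq]
    nlinarith
  · intro i hi
    refine (pbar_pow_le hlam hls hs (by linarith [mul_nonneg (zero_le_one.trans hD1) hs])
      hi).trans ?_
    gcongr
    linarith

end LatentGraphModel

/-- The numerical bound on the rows of the Gram matrix. -/
lemma row_bound_le {D : ℕ} {K y s z : ℝ} (hD : 2 ≤ D) (hK : 1 ≤ K) (hy : 0 ≤ y) (hsy : s ≤ y)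
    (hyD : (D : ℝ) ^ 8 * y ≤ 1) (hz : (D : ℝ) ^ 3 * y ≤ z) :
    2 * K * ((1 + y) ^ (2 * D) - 1) + 2 * (D * s) +
        2 * K * (1 + y) ^ (2 * D) * ((4 * D + 1) * ((1 + y) ^ (6 * D) ^ 2 - 1)) ≤
      2200 * K * z := by
  have hD2 : (2 : ℝ) ≤ D := by exact_mod_cast hD
  have hD6 : (64 : ℝ) ≤ (D : ℝ) ^ 6 := by
    calc (64 : ℝ) = 2 ^ 6 := by norm_num
      _ ≤ _ := by gcongr
  have h36 : ((6 * D) ^ 2 : ℝ) * y ≤ 1 := by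
    refine le_trans ?_ hyD
    have : ((6 * D) ^ 2 : ℝ) ≤ (D : ℝ) ^ 8 := by nlinarith [sq_nonneg (D : ℝ)]
    gcongr
  have h2 : (2 * D : ℝ) * y ≤ 1 := by
    refine le_trans ?_ h36
    have : (2 * D : ℝ) ≤ (6 * D) ^ 2 := by nlinarith
    gcongr
  have e1 : (1 + y) ^ (2 * D) ≤ 1 + 2 * ((2 * D) * y) := by
    have := one_add_pow_le hy (m := 2 * D) (by push_cast; exact h2)
    push_cast at this
    exact this
  have e2 : (1 + y) ^ (6 * D) ^ 2 ≤ 1 + 2 * ((6 * D) ^ 2 * y) := by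
    have := one_add_pow_le hy (m := (6 * D) ^ 2) (by push_cast; exact h36)
    push_cast at this
    exact this
  have e3 : (1 + y) ^ (2 * D) ≤ 3 := by linarith
  have hw : 0 ≤ (D : ℝ) ^ 2 * y := by positivity
  have hDy : (D : ℝ) * y ≤ (D : ℝ) ^ 3 * y := by
    gcongr
    nlinarith
  have hDDy : (D : ℝ) ^ 2 * y ≤ (D : ℝ) ^ 3 * y := by
    gcongr <;> linarith
  have hz0 : 0 ≤ (D : ℝ) ^ 3 * y := by positivity
  calc _ ≤ 2 * K * (2 * ((2 * D) * y)) + 2 * (D * y) +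
        2 * K * 3 * ((4 * D + 1) * (2 * ((6 * D) ^ 2 * y))) := by
        have h1 : (1 + y) ^ (2 * D) - 1 ≤ 2 * ((2 * D) * y) := by linarith
        have h3 : (1 + y) ^ (6 * D) ^ 2 - 1 ≤ 2 * ((6 * D) ^ 2 * y) := by linarith
        have h4 : 0 ≤ (1 + y) ^ (6 * D) ^ 2 - 1 := by
          have : (1 : ℝ) ≤ (1 + y) ^ (6 * D) ^ 2 := one_le_pow₀ (by linarith)
          linarith
        gcongr
    -- The leading term has size `D ^ 3 * y`: a factor `D` from the number of sizes of the new node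
    -- set, `D ^ 2` from the possible edges.
    _ = K * (8 * (D * y) + 1728 * (D ^ 3 * y) + 432 * (D ^ 2 * y)) + 2 * (D * y) := by ring
    _ ≤ K * (8 * (D ^ 3 * y) + 1728 * (D ^ 3 * y) + 432 * (D ^ 3 * y)) +
        K * (2 * (D ^ 3 * y)) := by
        have : 2 * ((D : ℝ) * y) ≤ K * (2 * (D ^ 3 * y)) := by nlinarith
        gcongr
    _ = 2170 * K * (D ^ 3 * y) := by ring
    _ ≤ 2200 * K * z := by
        gcongr
        norm_num

end

theorem mainTheorem5 (cm cv1 cv2 cv3 cv4 : ℝ)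
    (hcm : 0 ≤ cm) (hcv1 : 0 ≤ cv1) (hcv2 : 0 ≤ cv2) (hcv3 : 0 ≤ cv3) (hcv4 : 1 ≤ cv4) :
    ∃ c₀ : ℝ, 1 < c₀ ∧ ∃ c : ℝ, 0 < c ∧
      ∀ cs : ℝ, c₀ ≤ cs → ∀ D : ℕ, 2 ≤ D → ∀ n k : ℕ, 1 ≤ k → k ≤ n →
      ∀ (M : LatentGraphModel n) (lam : ℝ),
        M.CSignal D k lam cs →
        M.CMoment D k lam cm →
        M.CVariance D k lam cv1 cv2 cv3 cv4 →
      ∀ 𝒢 : Finset FinGraph, IsTemplateCollection D 𝒢 →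
      ∀ (α₀ : ℝ) (α : FinGraph → ℝ),
        (1 - c * (D : ℝ) ^ (-cs / 2)) * (α₀ ^ 2 + ∑ G ∈ 𝒢, α G ^ 2)
            ≤ ∫ A, (α₀ + ∑ G ∈ 𝒢, α G * M.psi G A) ^ 2 ∂M.law ∧
          ∫ A, (α₀ + ∑ G ∈ 𝒢, α G * M.psi G A) ^ 2 ∂M.law
            ≤ (1 + c * (D : ℝ) ^ (-cs / 2)) * (α₀ ^ 2 + ∑ G ∈ 𝒢, α G ^ 2) := by
  -- This generous `c₀` ensures `8 ≤ 3 * cs`, `1 + 2 * (cm + cv1) ≤ 2 * cs` and `3 - 3 * cs ≤ -cs /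
  -- 2`, the comparisons of exponents made below.
  refine ⟨10 + 2 * (cm + cv1), by linarith, 2200 * (1 + cv2), by linarith, ?_⟩
  intro cs hcs D hD n k hk hkn M lam hS hm hv 𝒢 h𝒢 α₀ α
  have hn : n ≠ 0 := by omega
  have hn0 : (0 : ℝ) < n := by exact_mod_cast Nat.pos_of_ne_zero hn
  have hD2 : (2 : ℝ) ≤ D := by exact_mod_cast hD
  have hD0 : (0 : ℝ) < D := by linarith
  have hD1 : (1 : ℝ) ≤ D := by linarith
  obtain ⟨hΘ, hsig⟩ := hS
  obtain ⟨hsig, hlq⟩ := max_le_iff.1 hsig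
  obtain ⟨hkn', hlk⟩ := max_le_iff.1 hsig
  have hmono : ∀ {x x' : ℝ}, x ≤ x' → (D : ℝ) ^ x ≤ (D : ℝ) ^ x' :=
    fun h => Real.rpow_le_rpow_of_exponent_le hD1 h
  set s : ℝ := (D : ℝ) ^ (-8 * cs) with hs
  -- `y ^ 2 = D ^ (-6 * cs)` exceeds the signal level `s` by `D ^ (2 * cs)`, room for the factors `D
  -- ^ (cm + cv1)`, while `D ^ 3 * y` stays below the target rate.
  set y : ℝ := (D : ℝ) ^ (-3 * cs) with hy
  have hs0 : 0 < s := Real.rpow_pos_of_pos hD0 _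
  have hy0 : 0 < y := Real.rpow_pos_of_pos hD0 _
  have hsy : s ≤ y := hmono (by linarith)
  have hpowy : ∀ m : ℕ, (D : ℝ) ^ m * y = (D : ℝ) ^ (m - 3 * cs) := by
    intro m
    rw [hy, ← Real.rpow_natCast, ← Real.rpow_add hD0]
    congr 1
    ring
  have hyD : (D : ℝ) ^ 8 * y ≤ 1 := by
    rw [hpowy, ← Real.rpow_zero (D : ℝ)]
    refine hmono ?_
    push_cast
    linarith
  have hz : (D : ℝ) ^ 3 * y ≤ (D : ℝ) ^ (-cs / 2) := by
    rw [hpowy]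
    refine hmono ?_
    push_cast
    linarith
  have hy1 : y ≤ 1 := (le_mul_of_one_le_left hy0.le (one_le_pow₀ hD1)).trans hyD
  have hDs : 2 * (D * s) ≤ 1 := by
    refine le_trans ?_ hyD
    have : 2 * (D : ℝ) ≤ D ^ 8 := by
      calc 2 * (D : ℝ) ≤ D * D := by gcongr
        _ = D ^ 2 := by ring
        _ ≤ D ^ 8 := pow_le_pow_right₀ hD1 (by norm_num)
    calc 2 * (D * s) = 2 * D * s := by ring
      _ ≤ _ := by gcongr
  have hsy2 : 2 * (D : ℝ) ^ (2 * (cm + cv1)) * s ≤ y ^ 2 := by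
    have h1 : y ^ 2 = (D : ℝ) ^ (-6 * cs) := by
      rw [hy, ← Real.rpow_natCast, ← Real.rpow_mul hD0.le]
      congr 1
      push_cast
      ring
    calc 2 * (D : ℝ) ^ (2 * (cm + cv1)) * s ≤
          (D : ℝ) ^ (1 : ℝ) * (D : ℝ) ^ (2 * (cm + cv1)) * s := by
          rw [Real.rpow_one]
          gcongr
      _ = (D : ℝ) ^ (1 + 2 * (cm + cv1) + -8 * cs) := by
          rw [hs, ← Real.rpow_add hD0, ← Real.rpow_add hD0]
      _ ≤ _ := by
          rw [h1]
          exact hmono (by linarith)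
  -- As `k ≥ 1`, the bound `k / n ≤ s` forces `n ≥ 1 / s ≥ 2 * D`.
  have h2D : 2 * D ≤ n := by
    have h1 : (1 : ℝ) ≤ n * s := by
      rw [div_le_iff₀' hn0] at hkn'
      exact le_trans (by exact_mod_cast hk) hkn'
    have h2 : (2 * D : ℝ) * s ≤ n * s := by linarith
    exact_mod_cast le_of_mul_le_mul_right h2 hs0
  have hlam : 0 ≤ lam := (hΘ ⟨0, by omega⟩ ⟨0, by omega⟩).1.trans (hΘ ⟨0, by omega⟩ ⟨0, by omega⟩).2
  have hls : lam ≤ M.q * s := by rwa [div_le_iff₀' M.q_pos] at hlq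
  have hB := LatentGraphModel.momentBounds_of_conditions hcm hcv1 hcv2 hn hD hΘ hm hv hlq hlk
    hy0.le hy1 hDs hsy2
  have hδ : ∀ S : Finset (NodePair n), S.card ≤ D →
      |∫ A, M.mono S A ^ 2 ∂M.law - M.qbar ^ S.card| ≤ 2 * (D * s) * M.qbar ^ S.card := by
    intro S hS
    have h1 := M.integral_mono_sq_mem hn hΘ S
    have h2 := LatentGraphModel.pbar_pow_le hlam hls hs0.le
      (by linarith [mul_pos hD0 hs0]) hS
    rw [abs_of_nonneg (by linarith [h1.1])]
    linarith [h1.2]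
  have hmain := hB.abs_integral_sum_sq_sub_le hδ
    (fun S => open Classical in (if S = ∅ then α₀ else 0) + M.labeledCoeff 𝒢 α S)
  have hrow := row_bound_le hD (show 1 ≤ 1 + cv2 by linarith) hy0.le hsy hyD hz
  simp only [← M.sum_psi_eq h𝒢 α₀ α, M.sum_coeff_sq_eq h𝒢 h2D α₀ α] at hmain
  have hα : 0 ≤ α₀ ^ 2 + ∑ G ∈ 𝒢, α G ^ 2 :=
    add_nonneg (sq_nonneg _) (Finset.sum_nonneg fun _ _ => sq_nonneg _)
  have hfin := abs_le.1 (hmain.trans (mul_le_mul_of_nonneg_right hrow hα))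
  constructor
  · linarith [hfin.1]
  · linarith [hfin.2]
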